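/- Let $M$ be a loopless matroid of rank $d+1$ ($d\ge 0$) on a finite set $E$, with rank function $\operatorname{rk}_M$, and let $A_1,\dots,A_d$ be nonempty subsets of $E$. For matroids $N,N'$ on $E$, let $N\wedge N'$ be the matroid on $E$ whose spanning sets are the sets $S\cap S'$ with $S$ spanning in $N$ and $S'$ spanning in $N'$. For a nonempty $S\subseteq E$, let $H_S$ be the matroid on $E$ with bases $E\setminus\{i\}$, $i\in S$. Let $U_{1,E}$ be the uniform matroid of rank $1$ on $E$. The family $A_1,\dots,A_d$ satisfies the *dragon Hall–Rado condition* $\operatorname{DHR}(M)$ if $$\operatorname{rk}_M\Big(\bigcup_{j\in J}A_j\Big)\ \ge\ |J|+1\qquad\text{for every nonempty } J\subseteq\{1,\dots,d\}.$$ The Chow ring of $M$ is the graded ring $$A^\bullet(M)=\frac{\mathbb R[z_F : F \text{ a nonempty flat of } M]}{\big\langle z_Fz_{F'} : F,F'\text{ incomparable}\big\rangle+\big\langle \sum_{F\supseteq a}z_F : a \text{ a flat of rank } 1\big\rangle},$$ and for nonempty $S\subseteq E$ put $h_S(M)=-\sum_{G\supseteq S}z_G\in A^1(M)$, the sum over the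 flats $G$ of $M$ containing $S$. The degree map of $M$ is the linear map $\int_M:A^d(M)\to\mathbb R$ determined by $\int_M z_{F_1}\cdots z_{F_d}=1$ for every chain $F_1\subsetneq\cdots\subsetneq F_d$ of nonempty proper flats of $M$. **Theorem.** The degree map $\int_M$ is well defined: exactly one linear map $A^d(M)\to\mathbb R$ has the stated values. Moreover $$M\wedge H_{A_1}\wedge\cdots\wedge H_{A_d}=U_{1,E}\iff A_1,\dots,A_d\text{ satisfy }\operatorname{DHR}(M),$$ and $$\int_M h_{A_1}(M)\cdots h_{A_d}(M)=\begin{cases}1&\text{if }A_1,\dots,A_d\text{ satisfy }\operatorname{DHR}(M),\\0&\text{otherwise.}\end{cases}$$ -/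

import Mathlib

namespace SimplicialChow

open MvPolynomial

/-! ### Operations on matroids over a finite type -/

section MatroidOperations

variable {E : Type*} [Finite E]

/-- Augmentation property for the sets `I ∪ J`, `I` independent in `M` and `J` independent in `N`
(with the two parts disjoint). -/
theorem union_aug_aux (M N : Matroid E) {J₁ J₂ : Set E} (hJ₁ : M.Indep J₁) (hJ₂ : N.Indep J₂)
    (hJ : Disjoint J₁ J₂) (n : ℕ) : ∀ I₁ I₂ : Set E, M.Indep I₁ → N.Indep I₂ → Disjoint I₁ I₂ →
      (I₂ ∩ J₁).ncard + (I₁ ∩ J₂).ncard = n → (I₁ ∪ I₂).ncard < (J₁ ∪ J₂).ncard →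
      ∃ e ∈ J₁ ∪ J₂, e ∉ I₁ ∪ I₂ ∧ ∃ K L, M.Indep K ∧ N.Indep L ∧
        insert e (I₁ ∪ I₂) = K ∪ L := by
  induction n using Nat.strong_induction_on with
  | _ n ih =>
    intro I₁ I₂ hI₁ hI₂ hI hn hlt
    rw [Set.ncard_union_eq hI (Set.toFinite _) (Set.toFinite _),
      Set.ncard_union_eq hJ (Set.toFinite _) (Set.toFinite _)] at hlt
    have key : I₁.ncard < J₁.ncard ∨ I₂.ncard < J₂.ncard := by omega
    rcases key with h | h
    · obtain ⟨e, ⟨heJ, heI⟩, hins⟩ := hI₁.augment hJ₁ (by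
        rw [← (Set.toFinite I₁).cast_ncard_eq, ← (Set.toFinite J₁).cast_ncard_eq]
        exact_mod_cast h)
      by_cases he₂ : e ∈ I₂
      · have heJ₂ : e ∉ J₂ := fun h => Set.disjoint_left.1 hJ heJ h
        have hU : insert e I₁ ∪ (I₂ \ {e}) = I₁ ∪ I₂ := by
          ext x; by_cases hx : x = e <;> simp [hx, he₂]
        have h1 : ((I₂ \ {e}) ∩ J₁).ncard < (I₂ ∩ J₁).ncard := by
          apply Set.ncard_lt_ncard _ (Set.toFinite _)
          refine ⟨fun x hx => ⟨hx.1.1, hx.2⟩, fun hs => ?_⟩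
          exact (hs ⟨he₂, heJ⟩).1.2 rfl
        have h2 : insert e I₁ ∩ J₂ = I₁ ∩ J₂ := by
          rw [Set.insert_inter_of_notMem heJ₂]
        have hd : Disjoint (insert e I₁) (I₂ \ {e}) := by
          rw [Set.disjoint_left]
          rintro x (rfl | hx) hx'
          · exact hx'.2 rfl
          · exact Set.disjoint_left.1 hI hx hx'.1
        have := ih _ (by rw [← hn, h2]; omega) (insert e I₁) (I₂ \ {e}) hins
          (hI₂.subset Set.sdiff_subset) hd rfl (by
            rw [hU, Set.ncard_union_eq hI (Set.toFinite _) (Set.toFinite _),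
              Set.ncard_union_eq hJ (Set.toFinite _) (Set.toFinite _)]
            exact hlt)
        rwa [hU] at this
      · exact ⟨e, Or.inl heJ, by simp [heI, he₂], insert e I₁, I₂, hins, hI₂,
          (Set.insert_union).symm⟩
    · obtain ⟨e, ⟨heJ, heI⟩, hins⟩ := hI₂.augment hJ₂ (by
        rw [← (Set.toFinite I₂).cast_ncard_eq, ← (Set.toFinite J₂).cast_ncard_eq]
        exact_mod_cast h)
      by_cases he₁ : e ∈ I₁
      · have heJ₁ : e ∉ J₁ := fun h => Set.disjoint_left.1 hJ h heJ
        have hU : (I₁ \ {e}) ∪ insert e I₂ = I₁ ∪ I₂ := by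
          ext x; by_cases hx : x = e <;> simp [hx, he₁]
        have h1 : ((I₁ \ {e}) ∩ J₂).ncard < (I₁ ∩ J₂).ncard := by
          apply Set.ncard_lt_ncard _ (Set.toFinite _)
          refine ⟨fun x hx => ⟨hx.1.1, hx.2⟩, fun hs => ?_⟩
          exact (hs ⟨he₁, heJ⟩).1.2 rfl
        have h2 : insert e I₂ ∩ J₁ = I₂ ∩ J₁ := by
          rw [Set.insert_inter_of_notMem heJ₁]
        have hd : Disjoint (I₁ \ {e}) (insert e I₂) := by
          rw [Set.disjoint_right]
          rintro x (rfl | hx) hx'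
          · exact hx'.2 rfl
          · exact Set.disjoint_right.1 hI hx hx'.1
        have := ih _ (by rw [← hn, h2]; omega) (I₁ \ {e}) (insert e I₂)
          (hI₁.subset Set.sdiff_subset) hins hd rfl (by
            rw [hU, Set.ncard_union_eq hI (Set.toFinite _) (Set.toFinite _),
              Set.ncard_union_eq hJ (Set.toFinite _) (Set.toFinite _)]
            exact hlt)
        rwa [hU] at this
      · exact ⟨e, Or.inr heJ, by simp [heI, he₁], I₁, insert e I₂, hI₁, hins,
          (Set.union_insert).symm⟩

/-- The matroid union: its independent sets are the unions of an independent set of `M` and an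
independent set of `N`. -/
def matroidUnion (M N : Matroid E) : Matroid E :=
  (IndepMatroid.ofFinite (Set.toFinite (M.E ∪ N.E))
    (fun K => ∃ I J, M.Indep I ∧ N.Indep J ∧ K = I ∪ J)
    ⟨∅, ∅, M.empty_indep, N.empty_indep, by simp⟩
    (by
      rintro K K' ⟨I, J, hI, hJ, rfl⟩ hK
      exact ⟨I ∩ K, J ∩ K, hI.subset Set.inter_subset_left, hJ.subset Set.inter_subset_left, by
        rw [← Set.union_inter_distrib_right, Set.inter_eq_right.2 hK]⟩)
    (by
      rintro _ _ ⟨I₁, I₂, hI₁, hI₂, rfl⟩ ⟨J₁, J₂, hJ₁, hJ₂, rfl⟩ hlt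
      have h := union_aug_aux M N hJ₁ (hJ₂.subset (Set.sdiff_subset (t := J₁)))
        Set.disjoint_sdiff_right _ I₁ (I₂ \ I₁) hI₁ (hI₂.subset Set.sdiff_subset)
        Set.disjoint_sdiff_right rfl (by simpa using hlt)
      simpa using h)
    (by
      rintro K ⟨I, J, hI, hJ, rfl⟩
      exact Set.union_subset_union hI.subset_ground hJ.subset_ground)).matroid

/-- The matroid intersection `M ∧ N`: the matroid whose spanning sets are the intersections of a
spanning set of `M` and a spanning set of `N` (see `matroidInter_spanning_iff`). -/
def matroidInter (M N : Matroid E) : Matroid E :=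
  (matroidUnion M.dual N.dual).dual

theorem matroidInter_spanning_iff (M N : Matroid E) (h : M.E = N.E) (S : Set E) :
    (matroidInter M N).Spanning S ↔ ∃ S₁ S₂, M.Spanning S₁ ∧ N.Spanning S₂ ∧ S = S₁ ∩ S₂ := by
  have hE : (matroidInter M N).E = M.E := by simp [matroidInter, matroidUnion, h]
  constructor
  · intro hS
    have hc := hS.compl_coindep
    rw [hE, Matroid.coindep_def, matroidInter, Matroid.dual_dual] at hc
    obtain ⟨I, J, hI, hJ, hIJ⟩ := hc
    refine ⟨M.E \ I, N.E \ J, Matroid.Coindep.compl_spanning hI, Matroid.Coindep.compl_spanning hJ,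
      ?_⟩
    have hSE : S ⊆ M.E := hE ▸ hS.subset_ground
    rw [← h, Set.sdiff_inter_sdiff, ← hIJ, Set.sdiff_sdiff_cancel_left hSE]
  · rintro ⟨S₁, S₂, h₁, h₂, rfl⟩
    rw [Matroid.spanning_iff_compl_coindep
      (by rw [hE]; exact Set.inter_subset_left.trans h₁.subset_ground), hE, Matroid.coindep_def,
      matroidInter, Matroid.dual_dual]
    exact ⟨M.E \ S₁, N.E \ S₂, h₁.compl_coindep, h₂.compl_coindep,
      by rw [← h, Set.sdiff_inter]⟩

theorem matroidInter_ground (M N : Matroid E) : (matroidInter M N).E = M.E ∪ N.E := rfl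

/-- The matroid `H_S` on `E`, for a nonempty subset `S` of `E`: its bases are the sets `E \ {i}`,
`i ∈ S`. -/
def hyperMatroid (S : Set E) (hS : S.Nonempty) : Matroid E :=
  Matroid.ofIsBaseOfFinite (E := Set.univ) (Set.toFinite _) (fun B => ∃ i ∈ S, B = {i}ᶜ)
    (hS.elim fun i hi => ⟨_, i, hi, rfl⟩)
    (by
      rintro _ _ ⟨i, hi, rfl⟩ ⟨j, hj, rfl⟩ a ⟨ha, ha'⟩
      obtain rfl : a = j := by simpa using ha'
      refine ⟨i, ⟨by simpa using Ne.symm ha, by simp⟩, a, hj, ?_⟩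
      ext x; by_cases hx : x = i <;> by_cases hx' : x = a <;> simp_all)
    (fun _ _ => Set.subset_univ _)

/-- The uniform matroid `U_{r,E}`: a set is independent if and only if it has at most `r`
elements. -/
def uniformMatroid (E : Type*) [Finite E] (r : ℕ) : Matroid E :=
  (IndepMatroid.ofFinite (E := Set.univ) (Set.toFinite _) (fun I => I.ncard ≤ r)
    (by simp)
    (fun _ _ hJ hIJ => (Set.ncard_le_ncard hIJ (Set.toFinite _)).trans hJ)
    (by
      intro I J _ hJ hlt
      obtain ⟨e, heJ, heI⟩ := Set.exists_mem_notMem_of_ncard_lt_ncard hlt (Set.toFinite _)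
      refine ⟨e, heJ, heI, ?_⟩
      rw [Set.ncard_insert_of_notMem heI (Set.toFinite _)]
      omega)
    (fun _ _ => Set.subset_univ _)).matroid

theorem matroidUnion_indep_iff (M N : Matroid E) (K : Set E) :
    (matroidUnion M N).Indep K ↔ ∃ I J, M.Indep I ∧ N.Indep J ∧ K = I ∪ J := Iff.rfl

theorem hyperMatroid_isBase_iff (S : Set E) (hS : S.Nonempty) (B : Set E) :
    (hyperMatroid S hS).IsBase B ↔ ∃ i ∈ S, B = {i}ᶜ := Iff.rfl

theorem uniformMatroid_indep_iff (r : ℕ) (I : Set E) :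
    (uniformMatroid E r).Indep I ↔ I.ncard ≤ r := Iff.rfl

/-- `M ∧ H_{A 0} ∧ ⋯ ∧ H_{A (d-1)}`, bracketed from the left. -/
def interHyper (M : Matroid E) {d : ℕ} (A : Fin d → Set E) (hA : ∀ i, (A i).Nonempty) :
    Matroid E :=
  (List.ofFn fun i => hyperMatroid (A i) (hA i)).foldl matroidInter M

/-- The dragon Hall–Rado condition of `M` for the family `A`. -/
def DragonHallRado (M : Matroid E) {d : ℕ} (A : Fin d → Set E) : Prop :=
  ∀ J : Finset (Fin d), J.Nonempty → (J.card : ℕ∞) + 1 ≤ M.eRk (⋃ j ∈ J, A j)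

end MatroidOperations

/-! ### The Chow ring of a matroid and its degree map -/

section ChowRing

variable {E : Type*} [Finite E]

/-- The nonempty flats of `M`. -/
abbrev NonemptyFlat (M : Matroid E) : Type _ := {F : Set E // M.IsFlat F ∧ F.Nonempty}

noncomputable instance (M : Matroid E) : Fintype (NonemptyFlat M) := Fintype.ofFinite _

open Classical in
/-- The ideal of relations of the Chow ring: `z_F z_{F'}` for incomparable `F`, `F'`, and
`∑_{F ⊇ a} z_F` for each atom (that is, flat of rank one) `a`. -/
noncomputable def chowIdeal (M : Matroid E) : Ideal (MvPolynomial (NonemptyFlat M) ℝ) :=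
  Ideal.span
    ({p | ∃ F G : NonemptyFlat M, ¬ F.1 ⊆ G.1 ∧ ¬ G.1 ⊆ F.1 ∧ p = X F * X G} ∪
      {p | ∃ a : NonemptyFlat M, M.eRk a.1 = 1 ∧
        p = ∑ F : NonemptyFlat M with a.1 ⊆ F.1, X F})

/-- The Chow ring `A^•(M)` of `M`, with real coefficients. -/
abbrev ChowRing (M : Matroid E) : Type _ := MvPolynomial (NonemptyFlat M) ℝ ⧸ chowIdeal M

/-- The graded piece `A^k(M)`: the classes of the homogeneous polynomials of degree `k`. -/
noncomputable def chowPiece (M : Matroid E) (k : ℕ) : Submodule ℝ (ChowRing M) :=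
  (homogeneousSubmodule (NonemptyFlat M) ℝ k).map (Ideal.Quotient.mkₐ ℝ (chowIdeal M)).toLinearMap

/-- The class of the variable `z_F`. -/
noncomputable def chowVar (M : Matroid E) (F : NonemptyFlat M) : ChowRing M :=
  Ideal.Quotient.mkₐ ℝ (chowIdeal M) (X F)

open Classical in
/-- The simplicial generator `h_S = - ∑_{G ⊇ S} z_G`, the sum being over the nonempty flats `G` of
`M` that contain `S`. -/
noncomputable def simplicialGen (M : Matroid E) (S : Set E) : ChowRing M :=
  - ∑ G : NonemptyFlat M with S ⊆ G.1, chowVar M G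

theorem chowVar_mem (M : Matroid E) (F : NonemptyFlat M) : chowVar M F ∈ chowPiece M 1 :=
  ⟨X F, isHomogeneous_X ℝ F, rfl⟩

theorem simplicialGen_mem (M : Matroid E) (S : Set E) : simplicialGen M S ∈ chowPiece M 1 :=
  Submodule.neg_mem _ (Submodule.sum_mem _ fun G _ => chowVar_mem M G)

theorem chowPiece_prod_mem (M : Matroid E) {d : ℕ} (x : Fin d → ChowRing M)
    (hx : ∀ i, x i ∈ chowPiece M 1) : ∏ i, x i ∈ chowPiece M d := by
  choose p hp hpx using hx
  refine ⟨∏ i, p i, ?_, ?_⟩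
  · have := IsHomogeneous.prod Finset.univ p (fun _ => 1) (fun i _ => hp i)
    simpa using this
  · simp only [AlgHom.toLinearMap_apply, map_prod] at hpx ⊢
    exact Finset.prod_congr rfl fun i _ => hpx i

/-- The property determining the degree map of a matroid of rank `d + 1`: it takes the value `1` on
`z_{F_1} ⋯ z_{F_d}` for every chain `F_1 ⊊ ⋯ ⊊ F_d` of nonempty proper flats. -/
def IsDegreeMap (M : Matroid E) (d : ℕ) (φ : chowPiece M d →ₗ[ℝ] ℝ) : Prop :=
  ∀ F : Fin d → NonemptyFlat M, StrictMono (fun i => (F i).1) → (∀ i, (F i).1 ≠ M.E) →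
    φ ⟨∏ i, chowVar M (F i), chowPiece_prod_mem M _ fun i => chowVar_mem M (F i)⟩ = 1

open Classical in
/-- The degree map `∫_M : A^d(M) → ℝ` of a loopless matroid of rank `d + 1`: the linear map
determined by `IsDegreeMap`. (The value `0` is a convention for the case that there is none.) -/
noncomputable def degreeMap (M : Matroid E) (d : ℕ) : chowPiece M d →ₗ[ℝ] ℝ :=
  if hφ : ∃ φ, IsDegreeMap M d φ then hφ.choose else 0

end ChowRing

end SimplicialChow

open SimplicialChow

/-!
The simplicial generators `h_F`, for nonempty flats `F`, are related to the variables `z_F` by an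
invertible linear change of variables (Möbius inversion), so a linear functional on the polynomial
ring can be prescribed by its values on monomials in the `h_F`. Let `Φ` be the functional with value
`1` on `h_{F_1} ⋯ h_{F_k}` if `F_1, …, F_k` satisfy the dragon Hall–Rado condition and `0`
otherwise (`dhrFunctional`, `toSimplicial`). The degree map is defined, and computed on simplicial
generators, at one stroke, by showing that `Φ` descends to the Chow ring (`exists_chowFunctional`),
takes the value `1` on complete flags (`apply_prod_flag_eq_one`), and is determined in degree `d` by
the latter (`IsDegreeMap.unique`).

* **Truncation.** `M ∧ H_S` is the principal truncation of `M` along the flat spanned by `S`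
  (`matroidInter_hyperMatroid_indep_iff`): the rank of `X` drops by one exactly if `S` lies in the
  closure of `X`. Hence `S, A_1, …, A_k` satisfy the condition for `M` if and only if `S` has rank
  at least two and `A_1, …, A_k` satisfy the condition for `M ∧ H_S`
  (`multisetDHR_cons_iff`). Rank at least two is also what is needed for `M ∧ H_S` to be loopless,
  and loops persist under further intersections; this gives the statement on
  `M ∧ H_{A_1} ∧ ⋯ ∧ H_{A_d}` by induction (`interHyper_eq_uniformMatroid_iff`).
* **Descent.** The linear relation of an atom `a` says that `h_a = 0`, and sets of rank one violate
  the condition. For the relation `z_F z_G = 0` with `F` and `G` incomparable, multiplied by a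
  monomial in the `h`'s, truncate along the flats of that monomial; what remains is the condition
  for a pair in a quotient `N` of `M`, namely `rk F ≥ 2`, `rk G ≥ 2` and `rk (F ∪ G) ≥ 3`, whose
  Möbius transform at an incomparable pair vanishes (`sum_sum_flatMu_eq_zero`).
* **Flags.** For a complete flag `F_1 ⊊ ⋯ ⊊ F_d ⊊ F_{d+1} = E`, trade `z_{F_k}` for
  `h_{F_{k+1}} - h_{F_k}`; the second term contributes `0`, since `h_{F_2} ⋯ h_{F_k} h_{F_k}`
  violates the condition. This ends at `h_{F_2} ⋯ h_{F_{d+1}}`, on which `Φ` is `1`.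
* **Uniqueness.** A monomial supported on a chain in which a factor `z_F` is repeated, or `F = E`,
  is by the linear relations a combination of monomials that involve one more proper flat
  (`cons_prod_chowVar_mem`); so complete flags span `A^d(M)` (`chowPiece_le_span`).
-/

namespace SimplicialChow

/-! ### Principal truncation of a matroid -/

section Truncation

variable {E : Type*} [Finite E] {M : Matroid E} {S X I : Set E}

theorem hyperMatroid_spanning_iff (hS : S.Nonempty) (T : Set E) :
    (hyperMatroid S hS).Spanning T ↔ ∃ i ∈ S, {i}ᶜ ⊆ T := by
  rw [Matroid.spanning_iff_exists_isBase_subset (Set.subset_univ T)]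
  simp only [hyperMatroid_isBase_iff]
  constructor
  · rintro ⟨_, ⟨i, hi, rfl⟩, h⟩
    exact ⟨i, hi, h⟩
  · rintro ⟨i, hi, h⟩
    exact ⟨_, ⟨i, hi, rfl⟩, h⟩

theorem matroidInter_hyperMatroid_ground (hE : M.E = Set.univ) (hS : S.Nonempty) :
    (matroidInter M (hyperMatroid S hS)).E = Set.univ := by
  rw [matroidInter_ground, hE, Set.univ_union]

theorem matroidInter_hyperMatroid_spanning_iff (hE : M.E = Set.univ) (hS : S.Nonempty) :
    (matroidInter M (hyperMatroid S hS)).Spanning X ↔ ∃ i ∈ S, M.Spanning (insert i X) := by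
  rw [matroidInter_spanning_iff _ _ hE]
  simp only [hyperMatroid_spanning_iff]
  constructor
  · rintro ⟨S₁, S₂, h₁, ⟨i, hi, h₂⟩, rfl⟩
    refine ⟨i, hi, h₁.superset (fun x hx => ?_) (hE ▸ Set.subset_univ _)⟩
    by_cases hxi : x = i
    · exact Or.inl hxi
    · exact Or.inr ⟨hx, h₂ hxi⟩
  · rintro ⟨i, hi, h⟩
    by_cases hiX : i ∈ X
    · rw [Set.insert_eq_of_mem hiX] at h
      exact ⟨X, Set.univ, h, ⟨i, hi, Set.subset_univ _⟩, by simp⟩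
    · refine ⟨_, {i}ᶜ, h, ⟨i, hi, subset_rfl⟩, ?_⟩
      ext x
      by_cases hx : x = i <;> simp [hx, hiX]

/-- Independent sets can only be lost when a matroid is intersected with another one. -/
theorem Indep.of_matroidInter {M N : Matroid E} (h : M.E = N.E)
    (hI : (matroidInter M N).Indep I) : M.Indep I := by
  obtain ⟨B, hB, hIB⟩ := hI.exists_isBase_superset
  obtain ⟨S₁, S₂, h₁, h₂, rfl⟩ := (matroidInter_spanning_iff M N h B).1 hB.spanning
  obtain ⟨B₁, hB₁, hBS⟩ := h₁.exists_isBase_subset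
  have hsp : (matroidInter M N).Spanning (B₁ ∩ S₂) :=
    (matroidInter_spanning_iff M N h _).2 ⟨_, _, hB₁.spanning, h₂, rfl⟩
  have := hB.eq_of_superset_spanning hsp (Set.inter_subset_inter_left _ hBS)
  exact hB₁.indep.subset ((hIB.trans this.subset).trans Set.inter_subset_left)

/-- `M ∧ H_S` is the principal truncation of `M` along the flat spanned by `S`. -/
theorem matroidInter_hyperMatroid_indep_iff [M.Loopless] (hE : M.E = Set.univ)
    (hS : S.Nonempty) :
    (matroidInter M (hyperMatroid S hS)).Indep I ↔ M.Indep I ∧ ¬ S ⊆ M.closure I := by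
  have hsub (Y : Set E) : Y ⊆ M.E := hE ▸ Set.subset_univ Y
  constructor
  · intro hI
    refine ⟨Indep.of_matroidInter (by rw [hE]; rfl) hI, fun hSI => ?_⟩
    obtain ⟨B, hB, hIB⟩ := hI.exists_isBase_superset
    have hSB : S ⊆ M.closure B := hSI.trans (M.closure_subset_closure hIB)
    obtain ⟨i, hi, hiB⟩ := (matroidInter_hyperMatroid_spanning_iff hE hS).1 hB.spanning
    have hBM : M.Indep B := Indep.of_matroidInter (by rw [hE]; rfl) hB.indep
    have hBsp : M.Spanning B := by
      rw [Matroid.spanning_iff_closure_eq (hsub _),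
        ← Matroid.closure_insert_eq_of_mem_closure (hSB hi)]
      exact hiB.closure_eq
    have hBb := hBM.isBase_of_spanning hBsp
    -- a basis of `M` through the nonloop `i`, contained in `insert i B`, loses `i`
    obtain ⟨C, hC, hiC⟩ := (Matroid.indep_singleton.2
      (M.isNonloop_of_loopless (hsub {i} rfl))).exists_isBase_subset_spanning hiB
        (by simp)
    have hsp : (matroidInter M (hyperMatroid S hS)).Spanning (C \ {i}) := by
      rw [matroidInter_hyperMatroid_spanning_iff hE hS]
      refine ⟨i, hi, hC.spanning.superset ?_ (hsub _)⟩
      intro x hx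
      by_cases hxi : x = i <;> simp [hxi, hx]
    have hsub' : C \ {i} ⊆ B := by
      rintro x ⟨hx, hxi⟩
      exact (hiC.2 hx).resolve_left hxi
    have heq := hB.eq_of_superset_spanning hsp hsub'
    have hcard := hC.ncard_eq_ncard_of_isBase hBb
    have : (C \ {i}).ncard < C.ncard :=
      Set.ncard_sdiff_singleton_lt_of_mem (hiC.1 rfl) (Set.toFinite _)
    rw [← heq] at this
    omega
  · rintro ⟨hI, hSI⟩
    obtain ⟨i, hi, hiI⟩ := Set.not_subset.1 hSI
    have hins : M.Indep (insert i I) := hI.insert_indep_iff.2 (Or.inl ⟨hsub {i} rfl, hiI⟩)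
    obtain ⟨B, hB, hIB⟩ := hins.exists_isBase_superset
    have hiB : i ∈ B := hIB (Set.mem_insert _ _)
    have hB' : (matroidInter M (hyperMatroid S hS)).IsBase (B \ {i}) := by
      apply Matroid.Spanning.isBase_of_minimal
      · rw [matroidInter_hyperMatroid_spanning_iff hE hS]
        exact ⟨i, hi, by rw [Set.insert_sdiff_singleton, Set.insert_eq_of_mem hiB]
                         exact hB.spanning⟩
      · intro Y hY hYB
        obtain ⟨j, hj, hjY⟩ := (matroidInter_hyperMatroid_spanning_iff hE hS).1 hY
        obtain ⟨C, hC, hCY⟩ := hjY.exists_isBase_subset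
        have h1 := hC.ncard_eq_ncard_of_isBase hB
        have h2 := Set.ncard_le_ncard hCY (Set.toFinite _)
        have h3 := Set.ncard_insert_le j Y
        have h4 := Set.ncard_sdiff_singleton_add_one hiB (Set.toFinite _)
        exact (Set.eq_of_subset_of_ncard_le hYB (by omega) (Set.toFinite _)).symm
    refine hB'.indep.subset fun x hx => ⟨hIB (Or.inr hx), ?_⟩
    rintro rfl
    exact hiI (M.mem_closure_of_mem hx (hsub _))

theorem eRk_matroidInter_hyperMatroid_le [M.Loopless] (hE : M.E = Set.univ)
    (hS : S.Nonempty) (X : Set E) :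
    (matroidInter M (hyperMatroid S hS)).eRk X ≤ M.eRk X :=
  Matroid.eRk_le_iff.2 fun _ hIX hI =>
    ((matroidInter_hyperMatroid_indep_iff hE hS).1 hI).1.encard_le_eRk_of_subset hIX

theorem eRk_matroidInter_hyperMatroid_of_not_subset [M.Loopless] (hE : M.E = Set.univ)
    (hS : S.Nonempty) (hX : ¬ S ⊆ M.closure X) :
    (matroidInter M (hyperMatroid S hS)).eRk X = M.eRk X := by
  refine (eRk_matroidInter_hyperMatroid_le hE hS X).antisymm ?_
  obtain ⟨I, hI⟩ := M.exists_isBasis X (hE ▸ Set.subset_univ X)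
  rw [hI.eRk_eq_encard]
  refine Matroid.Indep.encard_le_eRk_of_subset ?_ hI.subset
  rw [matroidInter_hyperMatroid_indep_iff hE hS, hI.closure_eq_closure]
  exact ⟨hI.indep, hX⟩

theorem eRk_matroidInter_hyperMatroid_of_subset [M.Loopless] (hE : M.E = Set.univ)
    (hS : S.Nonempty) (hX : S ⊆ M.closure X) :
    (matroidInter M (hyperMatroid S hS)).eRk X + 1 = M.eRk X := by
  have hsub (Y : Set E) : Y ⊆ M.E := hE ▸ Set.subset_univ Y
  apply le_antisymm
  · obtain ⟨J, hJ⟩ := (matroidInter M (hyperMatroid S hS)).exists_isBasis X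
      (matroidInter_hyperMatroid_ground hE hS ▸ Set.subset_univ X)
    obtain ⟨hJM, hSJ⟩ := (matroidInter_hyperMatroid_indep_iff hE hS).1 hJ.indep
    obtain ⟨i, hi, hiJ⟩ := Set.not_subset.1 hSJ
    have hins : M.Indep (insert i J) := hJM.insert_indep_iff.2 (Or.inl ⟨hsub {i} rfl, hiJ⟩)
    have hi' : i ∉ J := fun h => hiJ (M.mem_closure_of_mem h (hsub _))
    rw [hJ.eRk_eq_encard, ← Set.encard_insert_of_notMem hi', ← M.eRk_closure_eq X]
    exact hins.encard_le_eRk_of_subset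
      (Set.insert_subset (hX hi) (hJ.subset.trans (M.subset_closure X (hsub _))))
  · obtain ⟨i, hi⟩ := id hS
    obtain ⟨I, hI, hiI⟩ := (Matroid.indep_singleton.2
      (M.isNonloop_of_loopless (hsub {i} rfl))).subset_isBasis_of_subset
        (Set.singleton_subset_iff.2 (Set.mem_insert i X)) (hsub _)
    have hiI : i ∈ I := hiI rfl
    have hrk : M.eRk X = I.encard := by
      rw [← hI.eRk_eq_encard, ← M.eRk_closure_eq (insert i X),
        Matroid.closure_insert_eq_of_mem_closure (hX hi), M.eRk_closure_eq]
    rw [hrk, ← Set.encard_sdiff_singleton_add_one hiI]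
    gcongr
    refine Matroid.Indep.encard_le_eRk_of_subset ?_ (X := X)
      (fun x hx => (hI.subset hx.1).resolve_left hx.2)
    rw [matroidInter_hyperMatroid_indep_iff hE hS]
    exact ⟨hI.indep.subset Set.sdiff_subset,
      fun h => hI.indep.notMem_closure_sdiff_of_mem hiI (h hi)⟩

theorem isFlat_of_matroidInter_hyperMatroid [M.Loopless] (hE : M.E = Set.univ)
    (hS : S.Nonempty) (hX : (matroidInter M (hyperMatroid S hS)).IsFlat X) : M.IsFlat X := by
  have hsub (Y : Set E) : Y ⊆ M.E := hE ▸ Set.subset_univ Y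
  have hE' := matroidInter_hyperMatroid_ground hE hS
  have hrk : (matroidInter M (hyperMatroid S hS)).eRk (M.closure X) =
      (matroidInter M (hyperMatroid S hS)).eRk X := by
    by_cases h : S ⊆ M.closure X
    · have h1 := eRk_matroidInter_hyperMatroid_of_subset hE hS h
      have h2 := eRk_matroidInter_hyperMatroid_of_subset hE hS (X := M.closure X) (by simpa using h)
      rw [M.eRk_closure_eq, ← h1] at h2
      exact ENat.add_left_injective_of_ne_top ENat.one_ne_top h2
    · rw [eRk_matroidInter_hyperMatroid_of_not_subset hE hS h,
        eRk_matroidInter_hyperMatroid_of_not_subset hE hS (by simpa using h), M.eRk_closure_eq]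
  have hcl := ((matroidInter M (hyperMatroid S hS)).isRkFinite_of_finite
    (Set.toFinite _)).closure_eq_closure_of_subset_of_eRk_ge_eRk (M.subset_closure X (hsub _))
      hrk.le
  rw [hX.closure] at hcl
  rw [Matroid.isFlat_iff_closure_eq]
  refine (hcl ▸ Matroid.subset_closure _ _ (hE' ▸ Set.subset_univ _)).antisymm
    (M.subset_closure X (hsub _))

theorem loopless_matroidInter_hyperMatroid [M.Loopless] (hE : M.E = Set.univ)
    (hS : S.Nonempty) (h2 : 2 ≤ M.eRk S) : (matroidInter M (hyperMatroid S hS)).Loopless := by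
  have hsub (Y : Set E) : Y ⊆ M.E := hE ▸ Set.subset_univ Y
  rw [Matroid.loopless_iff_forall_isNonloop]
  intro e _
  rw [← Matroid.indep_singleton, matroidInter_hyperMatroid_indep_iff hE hS]
  refine ⟨Matroid.indep_singleton.2 (M.isNonloop_of_loopless (hsub {e} rfl)), fun h => ?_⟩
  have := (h2.trans (M.eRk_mono h)).trans (M.eRk_closure_eq {e}).le |>.trans (M.eRk_singleton_le e)
  exact absurd this (by decide)

theorem not_indep_singleton_matroidInter_hyperMatroid [M.Loopless] (hE : M.E = Set.univ)
    (hS : S.Nonempty) (h2 : ¬ 2 ≤ M.eRk S) {e : E} (he : e ∈ S) :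
    ¬ (matroidInter M (hyperMatroid S hS)).Indep {e} := by
  have hsub (Y : Set E) : Y ⊆ M.E := hE ▸ Set.subset_univ Y
  rw [matroidInter_hyperMatroid_indep_iff hE hS]
  rintro ⟨-, h⟩
  have h1 : M.eRk S ≤ M.eRk {e} := by
    rw [M.eRk_singleton_eq (hsub {e} rfl)]
    exact ENat.lt_two_iff.1 (not_le.1 h2)
  rw [(M.isRkFinite_of_finite (Set.toFinite _)).closure_eq_closure_of_subset_of_eRk_ge_eRk
    (Set.singleton_subset_iff.2 he) h1] at h
  exact h (M.subset_closure S (hsub _))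

end Truncation

/-! ### The dragon Hall–Rado condition for multisets -/

section MultisetCondition

variable {E : Type*} {M : Matroid E}

/-- The dragon Hall–Rado condition for a multiset of subsets: every nonempty submultiset `t` has a
union of rank at least `|t| + 1`. -/
def MultisetDHR (M : Matroid E) (s : Multiset (Set E)) : Prop :=
  ∀ t ≤ s, t ≠ 0 → (t.card : ℕ∞) + 1 ≤ M.eRk (⋃ X ∈ t, X)

theorem MultisetDHR.mono {s t : Multiset (Set E)} (hs : MultisetDHR M s) (h : t ≤ s) :
    MultisetDHR M t :=
  fun u hu => hs u (hu.trans h)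

theorem multisetDHR_zero : MultisetDHR M 0 :=
  fun _ ht h => absurd (Multiset.le_zero.1 ht) h

theorem biUnion_mem_cons (A : Set E) (s : Multiset (Set E)) :
    (⋃ X ∈ A ::ₘ s, X) = A ∪ ⋃ X ∈ s, X := by
  ext; simp

theorem le_cons_iff_le_or_eq_cons {α : Type*} {a : α} {s t : Multiset α} :
    t ≤ a ::ₘ s ↔ t ≤ s ∨ ∃ u ≤ s, t = a ::ₘ u := by
  classical
  constructor
  · intro h
    by_cases ha : a ∈ t
    · exact Or.inr ⟨t.erase a, Multiset.erase_le_iff_le_cons.2 h, (Multiset.cons_erase ha).symm⟩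
    · exact Or.inl ((Multiset.le_cons_of_notMem ha).1 h)
  · rintro (h | ⟨u, hu, rfl⟩)
    · exact h.trans (Multiset.le_cons_self s a)
    · exact (Multiset.cons_le_cons_iff a).2 hu

theorem exists_eq_map_of_le_map {α β : Type*} {f : α → β} {s : Multiset α} :
    ∀ {t : Multiset β}, t ≤ s.map f → ∃ u ≤ s, t = u.map f := by
  induction s using Multiset.induction_on with
  | empty => exact fun h => ⟨0, le_rfl, by simpa using h⟩
  | cons a s ih =>
    intro t ht
    rw [Multiset.map_cons] at ht
    rcases le_cons_iff_le_or_eq_cons.1 ht with ht | ⟨v, hv, rfl⟩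
    · obtain ⟨u, hu, rfl⟩ := ih ht
      exact ⟨u, hu.trans (Multiset.le_cons_self s a), rfl⟩
    · obtain ⟨u, hu, rfl⟩ := ih hv
      exact ⟨a ::ₘ u, (Multiset.cons_le_cons_iff a).2 hu, (Multiset.map_cons f a u).symm⟩

theorem multisetDHR_pair_iff (X Y : Set E) : MultisetDHR M (X ::ₘ Y ::ₘ 0) ↔
    2 ≤ M.eRk X ∧ 2 ≤ M.eRk Y ∧ 3 ≤ M.eRk (X ∪ Y) := by
  have h12 : (1 : ℕ∞) + 1 = 2 := one_add_one_eq_two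
  have h23 : (2 : ℕ∞) + 1 = 3 := two_add_one_eq_three
  constructor
  · intro h
    have h1 := h (X ::ₘ 0) (by simp) (by simp)
    have h2 := h (Y ::ₘ 0) (Multiset.le_cons_self _ _) (by simp)
    have h3 := h _ le_rfl (by simp)
    simp only [biUnion_mem_cons, Multiset.card_cons] at h1 h2 h3
    simpa [h12, h23] using And.intro h1 (And.intro h2 h3)
  · rintro ⟨h1, h2, h3⟩ t ht ht0
    rcases le_cons_iff_le_or_eq_cons.1 ht with ht | ⟨u, hu, rfl⟩
    · rcases le_cons_iff_le_or_eq_cons.1 ht with ht | ⟨v, hv, rfl⟩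
      · exact absurd (Multiset.le_zero.1 ht) ht0
      · rw [Multiset.le_zero] at hv
        simpa [hv, h12] using h2
    · rcases le_cons_iff_le_or_eq_cons.1 hu with hu | ⟨v, hv, rfl⟩
      · rw [Multiset.le_zero] at hu
        simpa [hu, h12] using h1
      · rw [Multiset.le_zero] at hv
        simpa [hv, h12, h23] using h3

theorem multisetDHR_map_iff {ι : Type*} (I : Finset ι) (A : ι → Set E) :
    MultisetDHR M (I.val.map A) ↔
      ∀ J ⊆ I, J.Nonempty → (J.card : ℕ∞) + 1 ≤ M.eRk (⋃ j ∈ J, A j) := by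
  constructor
  · intro h J hJI hJ
    have := h (J.val.map A) (Multiset.map_le_map (Finset.val_le_iff.2 hJI))
      (by simpa using hJ.ne_empty)
    simpa using this
  · intro h t ht ht0
    obtain ⟨u, hu, rfl⟩ := exists_eq_map_of_le_map ht
    have := h ⟨u, Multiset.nodup_of_le hu I.nodup⟩ (Finset.val_le_iff.1 hu)
      (Finset.nonempty_iff_ne_empty.2 fun h0 => ht0 (by
        rw [show u = 0 from congrArg Finset.val h0, Multiset.map_zero]))
    simpa using this

theorem dragonHallRado_iff_multisetDHR {d : ℕ} (A : Fin d → Set E) :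
    DragonHallRado M A ↔ MultisetDHR M (Finset.univ.val.map A) := by
  rw [multisetDHR_map_iff]
  exact ⟨fun h J _ => h J, fun h J => h J (Finset.subset_univ J)⟩

variable [Finite E]

/-- Truncating `M` along one member of the multiset removes it from the dragon Hall–Rado
condition. -/
theorem multisetDHR_cons_iff [M.Loopless] (hE : M.E = Set.univ) {A : Set E} (hA : A.Nonempty)
    (s : Multiset (Set E)) : MultisetDHR M (A ::ₘ s) ↔
      2 ≤ M.eRk A ∧ MultisetDHR (matroidInter M (hyperMatroid A hA)) s := by
  have hsub (Y : Set E) : Y ⊆ M.E := hE ▸ Set.subset_univ Y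
  constructor
  · intro h
    refine ⟨?_, fun t ht ht0 => ?_⟩
    · have := h {A} (Multiset.singleton_le.2 (Multiset.mem_cons_self _ _))
        (Multiset.singleton_ne_zero _)
      simpa [one_add_one_eq_two] using this
    · by_cases hAt : A ⊆ M.closure (⋃ X ∈ t, X)
      · have h1 := h (A ::ₘ t) ((Multiset.cons_le_cons_iff A).2 ht) (Multiset.cons_ne_zero)
        rw [biUnion_mem_cons, ← M.eRk_union_closure_right_eq, Set.union_eq_right.2 hAt,
          M.eRk_closure_eq, ← eRk_matroidInter_hyperMatroid_of_subset hE hA hAt,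
          Multiset.card_cons, Nat.cast_add, Nat.cast_one] at h1
        exact (ENat.add_le_add_iff_right ENat.one_ne_top).1 h1
      · rw [eRk_matroidInter_hyperMatroid_of_not_subset hE hA hAt]
        exact h t (ht.trans (Multiset.le_cons_self s A)) ht0
  · rintro ⟨h2, h⟩ t ht ht0
    rcases le_cons_iff_le_or_eq_cons.1 ht with ht | ⟨u, hu, rfl⟩
    · exact (h t ht ht0).trans (eRk_matroidInter_hyperMatroid_le hE hA _)
    · rcases eq_or_ne u 0 with rfl | hu0
      · simpa [one_add_one_eq_two] using h2
      rw [biUnion_mem_cons, Multiset.card_cons, Nat.cast_add, Nat.cast_one]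
      have h1 := h u hu hu0
      by_cases hAu : A ⊆ M.closure (⋃ X ∈ u, X)
      · rw [← M.eRk_union_closure_right_eq, Set.union_eq_right.2 hAu,
          M.eRk_closure_eq, ← eRk_matroidInter_hyperMatroid_of_subset hE hA hAu]
        gcongr
      · refine (add_le_add_left (h1.trans (eRk_matroidInter_hyperMatroid_le hE hA _)) 1).trans ?_
        obtain ⟨i, hi, hiu⟩ := Set.not_subset.1 hAu
        rw [← M.eRk_insert_eq_add_one ⟨hsub {i} rfl, hiu⟩]
        exact M.eRk_mono (Set.insert_subset (Or.inl hi) Set.subset_union_right)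

/-- Truncating `M` successively along the members of a multiset that satisfies the dragon Hall–Rado
condition. -/
theorem exists_truncation (s : Multiset (Set E)) (hs : ∀ X ∈ s, X.Nonempty) :
    ∀ (M : Matroid E) [M.Loopless], M.E = Set.univ → MultisetDHR M s →
      ∃ N : Matroid E, N.Loopless ∧ N.E = Set.univ ∧ (∀ X, N.IsFlat X → M.IsFlat X) ∧
        ∀ t, MultisetDHR M (t + s) ↔ MultisetDHR N t := by
  induction s using Multiset.induction_on with
  | empty => exact fun M hM hE _ => ⟨M, hM, hE, fun _ h => h, fun t => by rw [add_zero]⟩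
  | cons A s ih =>
    intro M _ hE hDHR
    have hA := hs A (Multiset.mem_cons_self A s)
    obtain ⟨h2, hDHR'⟩ := (multisetDHR_cons_iff hE hA s).1 hDHR
    have := loopless_matroidInter_hyperMatroid hE hA h2
    obtain ⟨N, hN, hNE, hflat, hiff⟩ := ih (fun X hX => hs X (Multiset.mem_cons_of_mem hX)) _
      (matroidInter_hyperMatroid_ground hE hA) hDHR'
    refine ⟨N, hN, hNE, fun X hX => isFlat_of_matroidInter_hyperMatroid hE hA (hflat X hX),
      fun t => ?_⟩
    rw [Multiset.add_cons, multisetDHR_cons_iff hE hA, hiff]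
    exact and_iff_right h2

/-! ### Iterated principal truncation -/

theorem eq_uniformMatroid_one [M.Loopless] (hE : M.E = Set.univ) (h : M.eRank = 1) :
    M = uniformMatroid E 1 := by
  refine Matroid.ext_indep (hE.trans rfl) fun I _ => ?_
  rw [uniformMatroid_indep_iff, Set.ncard_le_one_iff_subsingleton]
  constructor
  · intro hI
    exact Set.encard_le_one_iff_subsingleton.1 (h ▸ hI.encard_le_eRank)
  · intro hI
    rcases hI.eq_empty_or_singleton with rfl | ⟨e, rfl⟩
    · exact M.empty_indep
    · exact Matroid.indep_singleton.2 (M.isNonloop_of_loopless (hE ▸ Set.mem_univ e))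

theorem interHyper_succ {d : ℕ} (M : Matroid E) (A : Fin (d + 1) → Set E)
    (hA : ∀ i, (A i).Nonempty) : interHyper M A hA =
      interHyper (matroidInter M (hyperMatroid (A 0) (hA 0))) (fun i => A i.succ)
        (fun i => hA i.succ) := by
  rw [interHyper, List.ofFn_succ, List.foldl_cons, interHyper]

theorem Indep.of_interHyper {d : ℕ} {I : Set E} : ∀ {M : Matroid E} (_ : M.E = Set.univ)
    (A : Fin d → Set E) (hA : ∀ i, (A i).Nonempty), (interHyper M A hA).Indep I → M.Indep I := by
  induction d with
  | zero => exact fun _ A hA h => by simpa [interHyper] using h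
  | succ d ih =>
    intro M hE A hA h
    rw [interHyper_succ] at h
    exact Indep.of_matroidInter (by rw [hE]; rfl)
      (ih (matroidInter_hyperMatroid_ground hE (hA 0)) _ _ h)

theorem interHyper_eq_uniformMatroid_iff {d : ℕ} : ∀ {M : Matroid E} [M.Loopless]
    (_ : M.E = Set.univ) (_ : M.eRank = d + 1) (A : Fin d → Set E) (hA : ∀ i, (A i).Nonempty),
    interHyper M A hA = uniformMatroid E 1 ↔ MultisetDHR M (Finset.univ.val.map A) := by
  induction d with
  | zero =>
    intro M _ hE hr A hA
    have : interHyper M A hA = M := by simp [interHyper]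
    rw [this, Finset.univ_eq_empty]
    exact iff_of_true (eq_uniformMatroid_one hE (by simpa using hr)) multisetDHR_zero
  | succ d ih =>
    intro M _ hE hr A hA
    have hE' := matroidInter_hyperMatroid_ground hE (hA 0)
    have hmap : (Finset.univ.val.map A) =
        A 0 ::ₘ (Finset.univ.val.map fun i : Fin d => A i.succ) := by
      rw [Fin.univ_val_map, Fin.univ_val_map, List.ofFn_succ, Multiset.cons_coe]
    rw [interHyper_succ, hmap, multisetDHR_cons_iff hE (hA 0)]
    by_cases h2 : 2 ≤ M.eRk (A 0)
    · have := loopless_matroidInter_hyperMatroid hE (hA 0) h2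
      rw [and_iff_right h2]
      refine ih hE' ?_ _ _
      rw [← Matroid.eRk_ground, hE', ← ENat.add_left_injective_of_ne_top ENat.one_ne_top |>.eq_iff]
      rw [eRk_matroidInter_hyperMatroid_of_subset hE (hA 0), ← hE, M.eRk_ground, hr]
      · simp
      · rw [← hE, M.closure_ground, hE]
        exact Set.subset_univ _
    · refine iff_of_false (fun h => ?_) (fun h => h2 h.1)
      obtain ⟨e, he⟩ := hA 0
      refine not_indep_singleton_matroidInter_hyperMatroid hE (hA 0) h2 he
        (Indep.of_interHyper hE' _ _ (h.symm ▸ ?_ : (interHyper _ _ fun i => hA i.succ).Indep {e}))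
      rw [uniformMatroid_indep_iff, Set.ncard_singleton]

end MultisetCondition

open MvPolynomial

/-! ### Möbius sums over the flats -/

section Moebius

open IncidenceAlgebra

variable {E : Type*} [Finite E] {M : Matroid E}

open Classical in
noncomputable instance (M : Matroid E) : LocallyFiniteOrder (NonemptyFlat M) :=
  Fintype.toLocallyFiniteOrder

open Classical in
/-- The Möbius function of the poset of nonempty flats. -/
noncomputable def flatMu (M : Matroid E) (F G : NonemptyFlat M) : ℝ := mu ℝ F G

theorem flatMu_eq_zero {F G : NonemptyFlat M} (h : ¬ F ≤ G) : flatMu M F G = 0 :=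
  apply_eq_zero_of_not_le h _

theorem sum_flatMu_congr {F₀ : NonemptyFlat M} {a b : NonemptyFlat M → ℝ}
    (h : ∀ F, F₀ ≤ F → a F = b F) : ∑ F, flatMu M F₀ F * a F = ∑ F, flatMu M F₀ F * b F := by
  refine Finset.sum_congr rfl fun F _ => ?_
  by_cases hF : F₀ ≤ F
  · rw [h F hF]
  · rw [flatMu_eq_zero hF, zero_mul, zero_mul]

open Classical in
theorem sum_flatMu_mul_subset (F₀ : NonemptyFlat M) {X : Set E} (hX : M.IsFlat X) :
    ∑ F, flatMu M F₀ F * (if F.1 ⊆ X then 1 else 0) = if F₀.1 = X then 1 else 0 := by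
  rcases X.eq_empty_or_nonempty with rfl | hne
  · rw [if_neg F₀.2.2.ne_empty]
    refine Finset.sum_eq_zero fun F _ => ?_
    rw [if_neg fun h => F.2.2.ne_empty (Set.subset_empty_iff.1 h), mul_zero]
  · have h := sum_Icc_mu_right (𝕜 := ℝ) F₀ (⟨X, hX, hne⟩ : NonemptyFlat M)
    simp only [Subtype.ext_iff] at h
    rw [← h, ← Finset.sum_subset (Finset.subset_univ (Finset.Icc F₀ ⟨X, hX, hne⟩))]
    · refine Finset.sum_congr rfl fun F hF => ?_
      have : F.1 ⊆ X := (Finset.mem_Icc.1 hF).2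
      rw [if_pos this, mul_one, flatMu]
    · intro F _ hF
      by_cases hFX : F.1 ⊆ X
      · rw [flatMu_eq_zero fun h => hF (Finset.mem_Icc.2 ⟨h, hFX⟩), zero_mul]
      · rw [if_neg hFX, mul_zero]

open Classical in
theorem sum_flatMu_left (F₀ F : NonemptyFlat M) :
    ∑ G with F₀.1 ⊆ G.1, flatMu M G F = if F₀ = F then 1 else 0 := by
  rw [← sum_Icc_mu_left (𝕜 := ℝ) F₀ F]
  symm
  refine Finset.sum_subset_zero_on_sdiff (fun G hG => ?_) (fun G hG => ?_) (fun G _ => rfl)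
  · simpa using (Finset.mem_Icc.1 hG).1
  · simp only [Finset.mem_sdiff, Finset.mem_filter, Finset.mem_univ, true_and,
      Finset.mem_Icc, not_and] at hG
    exact flatMu_eq_zero (hG.2 hG.1)

open Classical in
/-- Let `N` be a quotient of `M`. For flats `F ⊇ F₀`, the condition that `F ∪ A` has rank at most
`k ≤ rk (F₀ ∪ A)` in `N` is either never satisfied, or equivalent to `F` being contained in the
flat of `N` spanned by `F₀ ∪ A`. -/
theorem sum_flatMu_mul_eRk {N : Matroid E} (hN : N.E = Set.univ) (hM : M.E = Set.univ)
    (hflat : ∀ X, N.IsFlat X → M.IsFlat X) {F₀ : NonemptyFlat M} (hF₀ : F₀.1 ≠ Set.univ)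
    (A : Set E) {k : ℕ∞} (hk : k ≤ N.eRk (F₀.1 ∪ A)) :
    ∑ F, flatMu M F₀ F * (if ¬ N.eRk (F.1 ∪ A) ≤ k then 1 else 0) =
      if N.eRk (F₀.1 ∪ A) = k ∧ F₀.1 = N.closure (F₀.1 ∪ A) then -1 else 0 := by
  have hsub (Y : Set E) : Y ⊆ N.E := hN ▸ Set.subset_univ Y
  have huniv : ∑ F, flatMu M F₀ F * 1 = 0 := by
    have := sum_flatMu_mul_subset F₀ (hM ▸ M.ground_isFlat : M.IsFlat Set.univ)
    simpa [hF₀] using this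
  rcases eq_or_ne (N.eRk (F₀.1 ∪ A)) k with rfl | hne
  · have key := sum_flatMu_mul_subset F₀ (hflat _ (N.isFlat_closure (F₀.1 ∪ A)))
    have hcongr : ∀ F : NonemptyFlat M, F₀ ≤ F →
        (if ¬ N.eRk (F.1 ∪ A) ≤ N.eRk (F₀.1 ∪ A) then (1 : ℝ) else 0) =
          1 - if F.1 ⊆ N.closure (F₀.1 ∪ A) then 1 else 0 := by
      intro F hF
      have hiff : N.eRk (F.1 ∪ A) ≤ N.eRk (F₀.1 ∪ A) ↔ F.1 ⊆ N.closure (F₀.1 ∪ A) := by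
        constructor
        · intro h
          rw [(N.isRkFinite_of_finite (Set.toFinite _)).closure_eq_closure_of_subset_of_eRk_ge_eRk
            (Set.union_subset_union_left A hF) h]
          exact Set.subset_union_left.trans (N.subset_closure _ (hsub _))
        · intro h
          rw [← N.eRk_closure_eq (F₀.1 ∪ A)]
          exact N.eRk_mono (Set.union_subset h
            (Set.subset_union_right.trans (N.subset_closure _ (hsub _))))
      by_cases h : F.1 ⊆ N.closure (F₀.1 ∪ A) <;> simp [hiff, h]
    rw [sum_flatMu_congr hcongr]
    simp only [mul_sub, Finset.sum_sub_distrib, huniv, key, true_and]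
    split_ifs <;> simp
  · rw [if_neg fun h => hne h.1, ← huniv]
    refine sum_flatMu_congr fun F hF => if_pos fun h => hne ?_
    exact ((N.eRk_mono (Set.union_subset_union_left A hF)).trans h).antisymm hk

open Classical in
/-- The identity behind `z_F z_G = 0` for incomparable `F₀` and `G₀`: the Möbius transform, in both
variables, of the dragon Hall–Rado condition for pairs vanishes. -/
theorem sum_sum_flatMu_eq_zero {N : Matroid E} [N.Loopless] (hN : N.E = Set.univ)
    (hM : M.E = Set.univ) (hflat : ∀ X, N.IsFlat X → M.IsFlat X) {F₀ G₀ : NonemptyFlat M}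
    (hFG : ¬ F₀.1 ⊆ G₀.1) (hGF : ¬ G₀.1 ⊆ F₀.1) :
    ∑ F, flatMu M F₀ F * ∑ G, flatMu M G₀ G *
      (if ¬ N.eRk F.1 ≤ 1 ∧ ¬ N.eRk G.1 ≤ 1 ∧ ¬ N.eRk (F.1 ∪ G.1) ≤ 2 then (1 : ℝ) else 0) = 0 := by
  have hsub (Y : Set E) : Y ⊆ N.E := hN ▸ Set.subset_univ Y
  have hF₀ : F₀.1 ≠ Set.univ := fun h => hGF (h ▸ Set.subset_univ _)
  have hG₀ : G₀.1 ≠ Set.univ := fun h => hFG (h ▸ Set.subset_univ _)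
  have hone (F : NonemptyFlat M) : 1 ≤ N.eRk F.1 := by
    obtain ⟨e, he⟩ := F.2.2
    rw [← N.eRk_singleton_eq (hsub {e} rfl)]
    exact N.eRk_mono (Set.singleton_subset_iff.2 he)
  -- the inner sum
  have inner : ∀ F : NonemptyFlat M, F₀ ≤ F → ∑ G, flatMu M G₀ G *
      (if ¬ N.eRk F.1 ≤ 1 ∧ ¬ N.eRk G.1 ≤ 1 ∧ ¬ N.eRk (F.1 ∪ G.1) ≤ 2 then (1 : ℝ) else 0) =
      (if N.eRk G₀.1 = 1 ∧ G₀.1 = N.closure G₀.1 then -1 else 0) *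
        (if ¬ N.eRk (F.1 ∪ G₀.1) ≤ 2 then 1 else 0) := by
    intro F hF
    by_cases h1 : N.eRk F.1 ≤ 1
    · rw [Finset.sum_eq_zero fun G _ => by rw [if_neg fun h => h.1 h1, mul_zero]]
      by_cases hG : N.eRk G₀.1 = 1
      · have : N.eRk (F.1 ∪ G₀.1) ≤ 2 := by
          rw [← one_add_one_eq_two]
          exact (N.eRk_union_le_eRk_add_eRk _ _).trans (add_le_add h1 hG.le)
        simp [this]
      · simp [hG]
    by_cases h2 : N.eRk (F.1 ∪ G₀.1) ≤ 2
    · have hF2 : N.eRk F.1 = 2 := by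
        refine ((N.eRk_mono Set.subset_union_left).trans h2).antisymm ?_
        rw [← not_lt, ENat.lt_two_iff]
        exact h1
      have hcl : N.closure F.1 = N.closure (F.1 ∪ G₀.1) :=
        (N.isRkFinite_of_finite (Set.toFinite _)).closure_eq_closure_of_subset_of_eRk_ge_eRk
          Set.subset_union_left (by rw [hF2]; exact h2)
      have hG₀F : G₀.1 ⊆ N.closure F.1 :=
        hcl ▸ Set.subset_union_right.trans (N.subset_closure _ (hsub _))
      have hcongr : ∀ G : NonemptyFlat M, G₀ ≤ G →
          (if ¬ N.eRk F.1 ≤ 1 ∧ ¬ N.eRk G.1 ≤ 1 ∧ ¬ N.eRk (F.1 ∪ G.1) ≤ 2 then (1 : ℝ) else 0) =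
            if ¬ N.eRk (G.1 ∪ F.1) ≤ 2 then 1 else 0 := by
        intro G hG
        rw [Set.union_comm G.1]
        refine if_congr ?_ rfl rfl
        refine ⟨fun h => h.2.2, fun h => ⟨h1, fun hG1 => h ?_, h⟩⟩
        -- a flat `G ⊇ G₀` of rank one lies in the line spanned by `F`
        have hGcl : G.1 ⊆ N.closure F.1 := by
          have := (N.isRkFinite_of_finite
            (Set.toFinite _)).closure_eq_closure_of_subset_of_eRk_ge_eRk hG (hG1.trans (hone G₀))
          refine (N.subset_closure G.1 (hsub _)).trans (this ▸ ?_)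
          exact N.closure_subset_closure_of_subset_closure hG₀F
        rw [← N.eRk_union_closure_left_eq, Set.union_eq_left.2 hGcl, N.eRk_closure_eq, hF2]
      rw [sum_flatMu_congr hcongr, sum_flatMu_mul_eRk hN hM hflat hG₀ F.1
        (by rw [← hF2]; exact N.eRk_mono Set.subset_union_right), if_neg, if_neg (not_not.2 h2),
        mul_zero]
      rintro ⟨-, h⟩
      exact hFG (h ▸ ((show F₀.1 ⊆ F.1 from hF).trans Set.subset_union_right).trans
        (N.subset_closure _ (hsub _)))
    · have hcongr : ∀ G : NonemptyFlat M, G₀ ≤ G →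
          (if ¬ N.eRk F.1 ≤ 1 ∧ ¬ N.eRk G.1 ≤ 1 ∧ ¬ N.eRk (F.1 ∪ G.1) ≤ 2 then (1 : ℝ) else 0) =
            if ¬ N.eRk (G.1 ∪ ∅) ≤ 1 then 1 else 0 := by
        intro G hG
        rw [Set.union_empty]
        exact if_congr ⟨fun h => h.2.1, fun h => ⟨h1, h, fun h' => h2
          ((N.eRk_mono (Set.union_subset_union_right F.1 hG)).trans h')⟩⟩ rfl rfl
      rw [sum_flatMu_congr hcongr, sum_flatMu_mul_eRk hN hM hflat hG₀ ∅
        (by rw [Set.union_empty]; exact hone G₀), Set.union_empty, if_pos h2, mul_one]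
  rw [sum_flatMu_congr inner]
  by_cases hG : N.eRk G₀.1 = 1 ∧ G₀.1 = N.closure G₀.1
  · have h2 : 2 ≤ N.eRk (F₀.1 ∪ G₀.1) := by
      rw [← not_lt, ENat.lt_two_iff]
      intro h
      have := (N.isRkFinite_of_finite
        (Set.toFinite _)).closure_eq_closure_of_subset_of_eRk_ge_eRk
          (Set.subset_union_right (s := F₀.1)) (h.trans (hone G₀))
      rw [← hG.2] at this
      exact hFG (this ▸ Set.subset_union_left.trans (N.subset_closure _ (hsub _)))
    simp only [if_pos hG, mul_left_comm _ (-1 : ℝ), ← Finset.mul_sum]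
    rw [sum_flatMu_mul_eRk hN hM hflat hF₀ G₀.1 h2, if_neg, mul_zero]
    rintro ⟨-, h⟩
    exact hGF (h ▸ Set.subset_union_right.trans (N.subset_closure _ (hsub _)))
  · simp [if_neg hG]

end Moebius

/-! ### The functional on the Chow ring -/

section Functional

variable {E : Type*}

theorem monomial_toFinsupp_eq_prod {σ : Type*} [DecidableEq σ] (s : Multiset σ) :
    monomial (Multiset.toFinsupp s) (1 : ℝ) = (s.map X).prod := by
  induction s using Multiset.induction_on with
  | empty => simp
  | cons a s ih =>
    rw [Multiset.map_cons, Multiset.prod_cons, ← ih, ← Multiset.singleton_add, map_add,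
      Multiset.toFinsupp_singleton, X, monomial_mul, one_mul]

/-- A linear functional on polynomials may be tested on products of variables. -/
theorem linearMap_apply_eq_zero_of_prod_X {σ : Type*} {L : MvPolynomial σ ℝ →ₗ[ℝ] ℝ}
    (h : ∀ s : Multiset σ, L (s.map X).prod = 0) (p : MvPolynomial σ ℝ) : L p = 0 := by
  classical
  have : L = 0 := by
    refine (basisMonomials σ ℝ).ext fun m => ?_
    rw [coe_basisMonomials]
    beta_reduce
    rw [← Finsupp.toMultiset_toFinsupp m, monomial_toFinsupp_eq_prod, h,
      LinearMap.zero_apply]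
  rw [this, LinearMap.zero_apply]

open Classical in
/-- The functional on polynomials in variables `x_F` that sends `x_{F_1} ⋯ x_{F_k}` to `1` if
`F_1, …, F_k` satisfy the dragon Hall–Rado condition, and to `0` otherwise. -/
noncomputable def dhrFunctional (M : Matroid E) :
    MvPolynomial (NonemptyFlat M) ℝ →ₗ[ℝ] ℝ :=
  (basisMonomials (NonemptyFlat M) ℝ).constr ℝ fun m =>
    if MultisetDHR M (m.toMultiset.map Subtype.val) then (1 : ℝ) else 0

open Classical in
theorem dhrFunctional_prod_X (M : Matroid E) (s : Multiset (NonemptyFlat M)) :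
    dhrFunctional M (s.map X).prod = if MultisetDHR M (s.map Subtype.val) then 1 else 0 := by
  rw [← monomial_toFinsupp_eq_prod, dhrFunctional,
    show monomial (Multiset.toFinsupp s) (1 : ℝ) =
      basisMonomials _ ℝ (Multiset.toFinsupp s) by rw [coe_basisMonomials],
    Module.Basis.constr_basis, Multiset.toFinsupp_toMultiset]

theorem not_multisetDHR_cons_of_eRk_le_one {M : Matroid E} {A : Set E} (hA : M.eRk A ≤ 1)
    (s : Multiset (Set E)) : ¬ MultisetDHR M (A ::ₘ s) := by
  intro h
  have := h {A} (Multiset.singleton_le.2 (Multiset.mem_cons_self _ _)) (by simp)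
  simp only [Multiset.card_singleton, Nat.cast_one, one_add_one_eq_two, Multiset.mem_singleton,
    Set.iUnion_iUnion_eq_left] at this
  exact absurd (this.trans hA) (by decide)

theorem multisetDHR_map_closure_iff {M : Matroid E} (s : Multiset (Set E)) :
    MultisetDHR M (s.map M.closure) ↔ MultisetDHR M s := by
  have key (t : Multiset (Set E)) :
      M.eRk (⋃ X ∈ t.map M.closure, X) = M.eRk (⋃ X ∈ t, X) := by
    rw [← M.eRk_closure_eq, ← M.eRk_closure_eq (⋃ X ∈ t, X)]
    congr 1
    induction t using Multiset.induction_on with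
    | empty => simp
    | cons A t ih =>
      rw [Multiset.map_cons, biUnion_mem_cons, biUnion_mem_cons, M.closure_union_closure_left_eq]
      exact M.closure_union_congr_right ih
  constructor
  · intro h t ht ht0
    have := h (t.map M.closure) (Multiset.map_le_map ht) (by simpa using ht0)
    rwa [key, Multiset.card_map] at this
  · intro h t ht ht0
    obtain ⟨u, hu, rfl⟩ := exists_eq_map_of_le_map ht
    rw [key, Multiset.card_map]
    exact h u hu fun h0 => ht0 (by rw [h0, Multiset.map_zero])

variable [Finite E]

/-- The change of variables from the `z_F` to the simplicial generators: Möbius inversion of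
`h_F = - ∑_{G ⊇ F} z_G`, the generator `h_F` being represented by the variable `X F`. -/
noncomputable def toSimplicial (M : Matroid E) :
    MvPolynomial (NonemptyFlat M) ℝ →ₐ[ℝ] MvPolynomial (NonemptyFlat M) ℝ :=
  aeval fun F => - ∑ G, C (flatMu M F G) * X G

variable {M : Matroid E}

theorem toSimplicial_X (F : NonemptyFlat M) :
    toSimplicial M (X F) = - ∑ G, C (flatMu M F G) * X G :=
  aeval_X _ F

open Classical in
theorem toSimplicial_sum (F : NonemptyFlat M) :
    toSimplicial M (∑ G : NonemptyFlat M with F.1 ⊆ G.1, X G) = - X F := by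
  simp only [map_sum, toSimplicial_X, Finset.sum_neg_distrib]
  rw [Finset.sum_comm]
  simp only [← Finset.sum_mul, ← map_sum, sum_flatMu_left]
  rw [Finset.sum_eq_single F (fun G _ hG => by rw [if_neg hG.symm, map_zero, zero_mul])
    (fun h => absurd (Finset.mem_univ F) h), if_pos rfl, map_one, one_mul]

theorem dhrFunctional_mul_toSimplicial_mul_eq_zero [M.Loopless] (hE : M.E = Set.univ)
    {F₀ G₀ : NonemptyFlat M} (hFG : ¬ F₀.1 ⊆ G₀.1) (hGF : ¬ G₀.1 ⊆ F₀.1)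
    (s : Multiset (NonemptyFlat M)) :
    dhrFunctional M ((s.map X).prod * (toSimplicial M (X F₀) * toSimplicial M (X G₀))) = 0 := by
  classical
  have expand : (s.map X).prod * (toSimplicial M (X F₀) * toSimplicial M (X G₀)) =
      ∑ F, flatMu M F₀ F • ∑ G, flatMu M G₀ G • ((F ::ₘ G ::ₘ s).map X).prod := by
    simp only [toSimplicial_X, Multiset.map_cons, Multiset.prod_cons, neg_mul_neg, Finset.smul_sum,
      Finset.sum_mul, Finset.mul_sum, smul_eq_C_mul]
    rw [Finset.sum_comm]
    refine Finset.sum_congr rfl fun F _ => Finset.sum_congr rfl fun G _ => ?_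
    ring
  rw [expand]
  simp only [map_sum, map_smul, smul_eq_mul, dhrFunctional_prod_X]
  simp only [Multiset.map_cons]
  by_cases hs : MultisetDHR M (s.map Subtype.val)
  · obtain ⟨N, hN, hNE, hflat, hiff⟩ := exists_truncation (s.map Subtype.val) (fun X hX => by
      obtain ⟨F, -, rfl⟩ := Multiset.mem_map.1 hX
      exact F.2.2) M hE hs
    refine Eq.trans ?_ (sum_sum_flatMu_eq_zero hNE hE hflat hFG hGF)
    refine Finset.sum_congr rfl fun F _ => congrArg _ (Finset.sum_congr rfl fun G _ =>
      congrArg _ (if_congr ?_ rfl rfl))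
    have := hiff (F.1 ::ₘ G.1 ::ₘ 0)
    rw [Multiset.cons_add, Multiset.cons_add, zero_add] at this
    rw [this, multisetDHR_pair_iff, ← not_lt, ← not_lt, ← not_lt, ENat.lt_two_iff,
      ENat.lt_two_iff, show (3 : ℕ∞) = 2 + 1 from two_add_one_eq_three.symm,
      ENat.lt_add_one_iff (by decide)]
  · refine Finset.sum_eq_zero fun F _ => mul_eq_zero_of_right _ (Finset.sum_eq_zero fun G _ => ?_)
    rw [if_neg fun h => hs (h.mono ((Multiset.le_cons_self _ _).trans (Multiset.le_cons_self _ _))),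
      mul_zero]

theorem dhrFunctional_toSimplicial_eq_zero [M.Loopless] (hE : M.E = Set.univ)
    {p : MvPolynomial (NonemptyFlat M) ℝ} (hp : p ∈ chowIdeal M) :
    dhrFunctional M (toSimplicial M p) = 0 := by
  classical
  suffices h : ∀ q, dhrFunctional M (q * toSimplicial M p) = 0 by simpa using h 1
  refine Submodule.span_induction (p := fun p _ => ∀ q, dhrFunctional M (q * toSimplicial M p) = 0)
    ?_ ?_ ?_ ?_ hp
  · intro p hp q
    refine linearMap_apply_eq_zero_of_prod_X
      (L := dhrFunctional M ∘ₗ LinearMap.mulRight ℝ (toSimplicial M p)) (fun s => ?_) q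
    rw [LinearMap.comp_apply, LinearMap.mulRight_apply]
    rcases hp with ⟨F, G, hFG, hGF, rfl⟩ | ⟨a, ha, rfl⟩
    · rw [map_mul (toSimplicial M)]
      exact dhrFunctional_mul_toSimplicial_mul_eq_zero hE hFG hGF s
    · have := dhrFunctional_prod_X M (a ::ₘ s)
      rw [Multiset.map_cons, Multiset.map_cons, if_neg (not_multisetDHR_cons_of_eRk_le_one ha.le _),
        Multiset.prod_cons] at this
      rw [toSimplicial_sum, mul_neg, map_neg, mul_comm, this, neg_zero]
  · simp
  · intro p₁ p₂ _ _ h₁ h₂ q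
    rw [map_add, mul_add, map_add, h₁, h₂, add_zero]
  · intro r p _ h q
    rw [smul_eq_mul, map_mul (toSimplicial M), ← mul_assoc, h]

/-- The generator of a set is that of the flat it spans, hence is represented by a variable after
the change of variables. -/
theorem simplicialGen_eq_mk (hE : M.E = Set.univ) {S : Set E} (hS : S.Nonempty) :
    ∃ F : NonemptyFlat M, F.1 = M.closure S ∧ ∃ p, simplicialGen M S =
      Ideal.Quotient.mkₐ ℝ (chowIdeal M) p ∧ toSimplicial M p = X F := by
  classical
  have hsub : S ⊆ M.E := hE ▸ Set.subset_univ S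
  let F : NonemptyFlat M := ⟨M.closure S, M.isFlat_closure S, hS.mono (M.subset_closure S hsub)⟩
  refine ⟨F, rfl, - ∑ G : NonemptyFlat M with F.1 ⊆ G.1, X G, ?_, ?_⟩
  · rw [map_neg, map_sum, simplicialGen]
    refine congrArg _ (Finset.sum_congr (Finset.filter_congr fun G _ => ?_) fun _ _ => rfl)
    exact ⟨fun h => G.2.1.closure ▸ M.closure_subset_closure h, (M.subset_closure S hsub).trans⟩
  · rw [map_neg, toSimplicial_sum, neg_neg]

theorem prod_simplicialGen_eq_mk (hE : M.E = Set.univ) {s : Multiset (Set E)}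
    (hs : ∀ X ∈ s, X.Nonempty) :
    ∃ u : Multiset (NonemptyFlat M), u.map Subtype.val = s.map M.closure ∧
      ∃ p, (s.map (simplicialGen M)).prod = Ideal.Quotient.mkₐ ℝ (chowIdeal M) p ∧
        toSimplicial M p = (u.map X).prod := by
  induction s using Multiset.induction_on with
  | empty => exact ⟨0, rfl, 1, by simp, by simp⟩
  | cons A s ih =>
    obtain ⟨u, hu, p, hp, hpu⟩ := ih fun X hX => hs X (Multiset.mem_cons_of_mem hX)
    obtain ⟨F, hF, q, hq, hqF⟩ := simplicialGen_eq_mk hE (hs A (Multiset.mem_cons_self A s))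
    refine ⟨F ::ₘ u, by rw [Multiset.map_cons, Multiset.map_cons, hF, hu], q * p, ?_, ?_⟩
    · rw [Multiset.map_cons, Multiset.prod_cons, hq, hp, map_mul]
    · rw [map_mul, hqF, hpu, Multiset.map_cons, Multiset.prod_cons]

/-- There is a linear functional on the Chow ring whose values on products of simplicial generators
are given by the dragon Hall–Rado condition. It is not homogeneous: it is the degree map on
`A^d(M)`, and in lower degree it is the degree after multiplication with a power of `h_E`. -/
theorem exists_chowFunctional (M : Matroid E) [M.Loopless] (hE : M.E = Set.univ) :
    ∃ ψ : ChowRing M →ₗ[ℝ] ℝ, ∀ s : Multiset (Set E), (∀ X ∈ s, X.Nonempty) →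
      (MultisetDHR M s → ψ (s.map (simplicialGen M)).prod = 1) ∧
      (¬ MultisetDHR M s → ∀ w, ψ ((s.map (simplicialGen M)).prod * w) = 0) := by
  classical
  have hsurj : Function.Surjective (Ideal.Quotient.mkₐ ℝ (chowIdeal M)).toLinearMap :=
    Ideal.Quotient.mkₐ_surjective ℝ (chowIdeal M)
  obtain ⟨r, hr⟩ := LinearMap.exists_rightInverse_of_surjective _
    (LinearMap.range_eq_top.2 hsurj)
  have hψ (p : MvPolynomial (NonemptyFlat M) ℝ) :
      (dhrFunctional M ∘ₗ (toSimplicial M).toLinearMap ∘ₗ r)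
        (Ideal.Quotient.mkₐ ℝ (chowIdeal M) p) = dhrFunctional M (toSimplicial M p) := by
    simp only [LinearMap.comp_apply, AlgHom.toLinearMap_apply]
    rw [← sub_eq_zero, ← map_sub, ← map_sub]
    exact dhrFunctional_toSimplicial_eq_zero hE (Ideal.Quotient.eq.1 (LinearMap.congr_fun hr _))
  refine ⟨dhrFunctional M ∘ₗ (toSimplicial M).toLinearMap ∘ₗ r, fun s hs => ?_⟩
  obtain ⟨u, hu, p, hp, hpu⟩ := prod_simplicialGen_eq_mk hE hs
  rw [hp]
  constructor
  · intro h
    rw [hψ, hpu, dhrFunctional_prod_X, hu, if_pos ((multisetDHR_map_closure_iff s).2 h)]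
  · intro h w
    obtain ⟨q, rfl⟩ := hsurj w
    rw [AlgHom.toLinearMap_apply, ← map_mul, hψ, map_mul, hpu]
    refine linearMap_apply_eq_zero_of_prod_X
      (L := dhrFunctional M ∘ₗ LinearMap.mulLeft ℝ (u.map X).prod) (fun t => ?_) _
    rw [LinearMap.comp_apply, LinearMap.mulLeft_apply, ← Multiset.prod_add, ← Multiset.map_add,
      dhrFunctional_prod_X, if_neg]
    intro h'
    rw [Multiset.map_add, hu] at h'
    exact h ((multisetDHR_map_closure_iff s).1 (h'.mono (Multiset.le_add_right _ _)))

end Functional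

/-! ### Complete flags of flats -/

section Flags

variable {E : Type*} {M : Matroid E}

theorem eRk_add_one_le_of_ssubset {X Y : Set E} (hX : M.IsFlat X) (hY : Y ⊆ M.E) (h : X ⊂ Y) :
    M.eRk X + 1 ≤ M.eRk Y := by
  obtain ⟨e, heY, heX⟩ := Set.exists_of_ssubset h
  rw [← M.eRk_insert_eq_add_one ⟨hY heY, by rwa [hX.closure]⟩]
  exact M.eRk_mono (Set.insert_subset heY h.subset)

theorem flag_mono {d : ℕ} {G : ℕ → NonemptyFlat M} (hG : ∀ i < d, (G i).1 ⊂ (G (i + 1)).1)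
    {i j : ℕ} (hij : i ≤ j) (hj : j ≤ d) : (G i).1 ⊆ (G j).1 := by
  induction j, hij using Nat.le_induction with
  | base => exact subset_rfl
  | succ j hij ih => exact (ih (by omega)).trans (hG j (by omega)).subset

/-- The `i`-th flat of a complete flag has rank `i + 1`. -/
theorem eRk_of_flag [M.Loopless] {d : ℕ} (hd : M.eRank = (d : ℕ∞) + 1)
    {G : ℕ → NonemptyFlat M} (hG : ∀ i < d, (G i).1 ⊂ (G (i + 1)).1) {i : ℕ} (hi : i ≤ d) :
    M.eRk (G i).1 = i + 1 := by
  have hstep (i : ℕ) (hi : i < d) := eRk_add_one_le_of_ssubset (G i).2.1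
    (G (i + 1)).2.1.subset_ground (hG i hi)
  apply le_antisymm
  · have key : ∀ j ≤ d, M.eRk (G (d - j)).1 + j ≤ d + 1 := by
      intro j
      induction j with
      | zero => exact fun _ => by simpa [← hd] using M.eRk_le_eRank _
      | succ j ih =>
        intro hj
        have h1 := hstep (d - (j + 1)) (by omega)
        rw [show d - (j + 1) + 1 = d - j by omega] at h1
        refine le_trans ?_ (ih (by omega))
        rw [Nat.cast_add, Nat.cast_one, add_comm (j : ℕ∞), ← add_assoc]
        gcongr
    have := key (d - i) (Nat.sub_le d i)
    rw [Nat.sub_sub_self hi] at this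
    have hcast : (d : ℕ∞) + 1 = (i + 1) + ((d - i : ℕ) : ℕ∞) := by
      norm_cast
      omega
    rw [hcast] at this
    exact (ENat.add_le_add_iff_right (ENat.natCast_ne_top _)).1 this
  · induction i with
    | zero =>
      obtain ⟨e, he⟩ := (G 0).2.2
      rw [Nat.cast_zero, zero_add, ← M.eRk_singleton_eq ((G 0).2.1.subset_ground he)]
      exact M.eRk_mono (Set.singleton_subset_iff.2 he)
    | succ i ih =>
      refine le_trans ?_ (hstep i hi)
      rw [Nat.cast_add, Nat.cast_one]
      gcongr
      exact ih (by omega)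

/-- The simplicial generators of a flag with ranks `2, …, d + 1` satisfy the dragon Hall–Rado
condition. -/
theorem multisetDHR_flag [M.Loopless] {d : ℕ} (hd : M.eRank = (d : ℕ∞) + 1)
    {G : ℕ → NonemptyFlat M} (hG : ∀ i < d, (G i).1 ⊂ (G (i + 1)).1) :
    MultisetDHR M ((Finset.Ico 1 (d + 1)).val.map fun j => (G j).1) := by
  rw [multisetDHR_map_iff]
  intro J hJ hne
  have hm := J.max'_mem hne
  have hmd := Finset.mem_Ico.1 (hJ hm)
  have hcard : J.card ≤ J.max' hne := by
    have : J ⊆ Finset.Icc 1 (J.max' hne) := fun j hj =>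
      Finset.mem_Icc.2 ⟨(Finset.mem_Ico.1 (hJ hj)).1, J.le_max' j hj⟩
    simpa using Finset.card_le_card this
  calc (J.card : ℕ∞) + 1 ≤ (J.max' hne : ℕ∞) + 1 := by gcongr
    _ = M.eRk (G (J.max' hne)).1 := (eRk_of_flag hd hG (by omega)).symm
    _ ≤ _ := M.eRk_mono (Set.subset_biUnion_of_mem (u := fun j => (G j).1) hm)

theorem not_multisetDHR_flag [M.Loopless] {d : ℕ} (hd : M.eRank = (d : ℕ∞) + 1)
    {G : ℕ → NonemptyFlat M} (hG : ∀ i < d, (G i).1 ⊂ (G (i + 1)).1) {k : ℕ} (hk : k ≤ d) :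
    ¬ MultisetDHR M ((G k).1 ::ₘ (Finset.Ico 1 (k + 1)).val.map fun j => (G j).1) := by
  intro h
  have h1 := h _ le_rfl (Multiset.cons_ne_zero)
  have h2 : (⋃ X ∈ (G k).1 ::ₘ (Finset.Ico 1 (k + 1)).val.map fun j => (G j).1, X) ⊆ (G k).1 := by
    refine Set.iUnion₂_subset fun X hX => ?_
    rcases Multiset.mem_cons.1 hX with rfl | hX
    · exact subset_rfl
    · obtain ⟨j, hj, rfl⟩ := Multiset.mem_map.1 hX
      have := Finset.mem_Ico.1 (Finset.mem_def.2 hj)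
      exact flag_mono hG (by omega) hk
  have h3 := h1.trans (M.eRk_mono h2)
  rw [eRk_of_flag hd hG hk, Multiset.card_cons, Multiset.card_map, Finset.card_val,
    Nat.card_Ico] at h3
  norm_cast at h3
  omega

variable [Finite E]

theorem chowVar_mul_chowVar_eq_zero {F G : NonemptyFlat M} (hFG : ¬ F.1 ⊆ G.1)
    (hGF : ¬ G.1 ⊆ F.1) : chowVar M F * chowVar M G = 0 := by
  rw [chowVar, chowVar, ← map_mul]
  exact Ideal.Quotient.eq_zero_iff_mem.2 (Ideal.subset_span (Or.inl ⟨F, G, hFG, hGF, rfl⟩))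

open Classical in
theorem sum_chowVar_mem_eq_zero [M.Loopless] (hE : M.E = Set.univ) (a : E) :
    ∑ G : NonemptyFlat M with a ∈ G.1, chowVar M G = 0 := by
  have ha : a ∈ M.E := hE ▸ Set.mem_univ a
  let A : NonemptyFlat M :=
    ⟨M.closure {a}, M.isFlat_closure _, a,
      M.mem_closure_of_mem rfl (Set.singleton_subset_iff.2 ha)⟩
  have hrk : M.eRk A.1 = 1 := by rw [M.eRk_closure_eq, M.eRk_singleton_eq ha]
  have h : Ideal.Quotient.mkₐ ℝ (chowIdeal M) (∑ F : NonemptyFlat M with A.1 ⊆ F.1, X F) = 0 :=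
    Ideal.Quotient.eq_zero_iff_mem.2 (Ideal.subset_span (Or.inr ⟨A, hrk, rfl⟩))
  rw [map_sum] at h
  rw [← h]
  refine Finset.sum_congr (Finset.filter_congr fun G _ => ?_) fun _ _ => rfl
  rw [← Set.singleton_subset_iff]
  exact ⟨fun h => G.2.1.closure ▸ M.closure_subset_closure h,
    (M.subset_closure _ (Set.singleton_subset_iff.2 ha)).trans⟩

/-- Modulo the variables of the flats incomparable with `G`, which are killed by `w`, the variable
of a flat `F` covered by `G` is the difference of two simplicial generators: only `F` itself contains
`F` and is properly contained in `G`. -/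
theorem chowVar_mul_eq_sub (hE : M.E = Set.univ) {F G : NonemptyFlat M}
    (hFG : F.1 ⊂ G.1) (hrk : M.eRk G.1 = M.eRk F.1 + 1) {w : ChowRing M}
    (hw : ∀ K : NonemptyFlat M, ¬ G.1 ⊆ K.1 → ¬ K.1 ⊆ G.1 → chowVar M K * w = 0) :
    chowVar M F * w = simplicialGen M G.1 * w - simplicialGen M F.1 * w := by
  classical
  have hsplit : ∑ K : NonemptyFlat M with F.1 ⊆ K.1, chowVar M K =
      ∑ K : NonemptyFlat M with G.1 ⊆ K.1, chowVar M K +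
        ∑ K : NonemptyFlat M with F.1 ⊆ K.1 ∧ ¬ G.1 ⊆ K.1, chowVar M K := by
    rw [← Finset.sum_filter_add_sum_filter_not
      (Finset.univ.filter fun K : NonemptyFlat M => F.1 ⊆ K.1) (fun K => G.1 ⊆ K.1), Finset.filter_filter, Finset.filter_filter]
    congr 2
    ext K
    simp only [Finset.mem_filter, Finset.mem_univ, true_and]
    exact ⟨fun h => h.2, fun h => ⟨hFG.subset.trans h, h⟩⟩
  have hw' : (∑ K : NonemptyFlat M with F.1 ⊆ K.1 ∧ ¬ G.1 ⊆ K.1, chowVar M K) * w =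
      chowVar M F * w := by
    rw [Finset.sum_mul]
    refine Finset.sum_eq_single F (fun K hK hne => ?_) (fun h => ?_)
    · obtain ⟨hFK, hGK⟩ := (Finset.mem_filter.1 hK).2
      refine hw K hGK fun hKG => hne (Subtype.ext ?_)
      by_contra hKF
      have h1 := eRk_add_one_le_of_ssubset F.2.1 (hE ▸ Set.subset_univ K.1)
        (hFK.ssubset_of_ne (Ne.symm hKF))
      have h2 := eRk_add_one_le_of_ssubset K.2.1 (hE ▸ Set.subset_univ G.1)
        (hKG.ssubset_of_not_subset hGK)
      rw [hrk] at h2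
      have h3 := (ENat.add_le_add_iff_right ENat.one_ne_top).1 h2
      have h4 := h1.trans h3
      rw [ENat.add_one_le_iff (Matroid.eRk_ne_top_iff.2
        (M.isRkFinite_of_finite (Set.toFinite _)))] at h4
      exact lt_irrefl _ h4
    · exact absurd (Finset.mem_filter.2 ⟨Finset.mem_univ F, subset_rfl, hFG.not_subset⟩) h
  rw [simplicialGen, simplicialGen, hsplit, ← hw']
  ring

/-- Every functional given by the dragon Hall–Rado condition takes the value `1` on complete flags:
the variables of the flag are traded one by one for simplicial generators. -/
theorem apply_prod_flag_eq_one [M.Loopless] (hE : M.E = Set.univ) {d : ℕ}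
    (hd : M.eRank = (d : ℕ∞) + 1) {ψ : ChowRing M →ₗ[ℝ] ℝ}
    (hψ : ∀ s : Multiset (Set E), (∀ X ∈ s, X.Nonempty) →
      (MultisetDHR M s → ψ (s.map (simplicialGen M)).prod = 1) ∧
      (¬ MultisetDHR M s → ∀ w, ψ ((s.map (simplicialGen M)).prod * w) = 0))
    {G : ℕ → NonemptyFlat M} (hG : ∀ i < d, (G i).1 ⊂ (G (i + 1)).1) (hGd : (G d).1 = Set.univ) :
    ψ (∏ j ∈ Finset.range d, chowVar M (G j)) = 1 := by
  have key : ∀ k ≤ d, ψ ((∏ j ∈ Finset.Ico 1 (k + 1), simplicialGen M (G j).1) *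
      ∏ j ∈ Finset.Ico k d, chowVar M (G j)) = ψ (∏ j ∈ Finset.range d, chowVar M (G j)) := by
    intro k
    induction k with
    | zero => simp
    | succ k ih =>
      intro hk
      rw [← ih (by omega), Finset.prod_Ico_succ_top (by omega),
        Finset.prod_eq_prod_Ico_succ_bot (show k < d by omega)]
      set w := ∏ j ∈ Finset.Ico (k + 1) d, chowVar M (G j) with hw
      have hsub := chowVar_mul_eq_sub hE (hG k (by omega)) (w := w)
        (by rw [eRk_of_flag hd hG (by omega), eRk_of_flag hd hG (by omega)]; norm_cast) (by
          intro K hGK hKG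
          rcases hk.lt_or_eq with hk' | hk'
          · rw [hw, Finset.prod_eq_prod_Ico_succ_bot hk', ← mul_assoc,
              chowVar_mul_chowVar_eq_zero hKG hGK, zero_mul]
          · rw [hk', hGd] at hKG
            exact absurd (Set.subset_univ _) hKG)
      have hzero := (hψ ((G k).1 ::ₘ (Finset.Ico 1 (k + 1)).val.map fun j => (G j).1) (by
        intro X hX
        rcases Multiset.mem_cons.1 hX with rfl | hX
        · exact (G k).2.2
        · obtain ⟨j, -, rfl⟩ := Multiset.mem_map.1 hX
          exact (G j).2.2)).2 (not_multisetDHR_flag hd hG (by omega)) w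
      rw [Multiset.map_cons, Multiset.prod_cons, Multiset.map_map] at hzero
      change ψ (_ * (∏ j ∈ Finset.Ico 1 (k + 1), simplicialGen M (G j).1) * w) = 0 at hzero
      rw [hsub, mul_sub, map_sub, ← mul_assoc, ← mul_assoc, mul_comm _ (simplicialGen M (G k).1),
        hzero, sub_zero]
  rw [← key d le_rfl, Finset.Ico_self, Finset.prod_empty, mul_one]
  have := (hψ ((Finset.Ico 1 (d + 1)).val.map fun j => (G j).1) (by
    intro X hX
    obtain ⟨j, -, rfl⟩ := Multiset.mem_map.1 hX
    exact (G j).2.2)).1 (multisetDHR_flag hd hG)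
  rwa [Multiset.map_map] at this

end Flags

/-! ### Complete flags span the top degree -/

section Span

theorem exists_mem_forall_notMem_of_isChain {α : Type*} [Finite α] {T : Set (Set α)}
    (hT : ∀ X ∈ T, ∀ Y ∈ T, X ⊆ Y ∨ Y ⊆ X) {F : Set α} (hF : F.Nonempty)
    (h : ∀ X ∈ T, X ⊂ F) : ∃ a ∈ F, ∀ X ∈ T, a ∉ X := by
  rcases T.eq_empty_or_nonempty with rfl | hne
  · obtain ⟨a, ha⟩ := hF
    exact ⟨a, ha, by simp⟩
  · obtain ⟨X, hX, hmax⟩ := Set.exists_max_image T Set.ncard (Set.toFinite T) hne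
    obtain ⟨a, haF, haX⟩ := Set.exists_of_ssubset (h X hX)
    refine ⟨a, haF, fun Y hY haY => ?_⟩
    rcases hT X hX Y hY with hXY | hYX
    · exact haX (Set.eq_of_subset_of_ncard_le hXY (hmax Y hY) (Set.toFinite _) ▸ haY)
    · exact haX (hYX haY)

theorem exists_notMem_forall_mem_of_isChain {α : Type*} [Finite α] {T : Set (Set α)}
    (hT : ∀ X ∈ T, ∀ Y ∈ T, X ⊆ Y ∨ Y ⊆ X) {F : Set α} (hF : F ≠ Set.univ)
    (h : ∀ X ∈ T, F ⊂ X) : ∃ b, b ∉ F ∧ ∀ X ∈ T, b ∈ X := by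
  obtain ⟨b, hb, hbT⟩ := exists_mem_forall_notMem_of_isChain (T := compl '' T) (F := Fᶜ)
    (by
      rintro _ ⟨X, hX, rfl⟩ _ ⟨Y, hY, rfl⟩
      simpa only [Set.compl_subset_compl] using (hT X hX Y hY).symm)
    (Set.nonempty_compl.2 hF)
    (by
      rintro _ ⟨X, hX, rfl⟩
      exact compl_lt_compl_iff_lt.2 (h X hX))
  exact ⟨b, hb, fun X hX => by simpa using hbT _ ⟨X, hX, rfl⟩⟩

variable {E : Type*} [Finite E] {M : Matroid E}

/-- The products of the variables along the complete flags of nonempty proper flats. -/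
def flagProducts (M : Matroid E) (d : ℕ) : Set (ChowRing M) :=
  {x | ∃ F : Fin d → NonemptyFlat M, StrictMono (fun i => (F i).1) ∧ (∀ i, (F i).1 ≠ M.E) ∧
    x = ∏ i, chowVar M (F i)}

/-- If a factor `z_F` of a chain monomial is repeated, or `F` is the ground set, then the linear
relations express the monomial by monomials in which a new proper flat replaces the factor. -/
theorem cons_prod_chowVar_mem [M.Loopless] (hE : M.E = Set.univ)
    (V : Submodule ℝ (ChowRing M)) {F : NonemptyFlat M} {s : Multiset (NonemptyFlat M)}
    (hchain : ∀ G ∈ F ::ₘ s, ∀ H ∈ F ::ₘ s, G.1 ⊆ H.1 ∨ H.1 ⊆ G.1)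
    (hF : F ∈ s ∨ F.1 = Set.univ)
    (hV : ∀ G ∉ s, G.1 ≠ Set.univ → chowVar M G * (s.map (chowVar M)).prod ∈ V) :
    chowVar M F * (s.map (chowVar M)).prod ∈ V := by
  classical
  set P := (s.map (chowVar M)).prod with hP
  have hFs : ∀ G ∈ s, F.1 ⊆ G.1 ∨ G.1 ⊆ F.1 := fun G hG =>
    hchain F (Multiset.mem_cons_self F s) G (Multiset.mem_cons_of_mem hG)
  have hss : ∀ G ∈ s, ∀ H ∈ s, G.1 ⊆ H.1 ∨ H.1 ⊆ G.1 := fun G hG H hH =>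
    hchain G (Multiset.mem_cons_of_mem hG) H (Multiset.mem_cons_of_mem hH)
  obtain ⟨a, haF, ha⟩ := exists_mem_forall_notMem_of_isChain
    (T := {X | ∃ G ∈ s, G.1 ⊂ F.1 ∧ G.1 = X})
    (by rintro _ ⟨G, hG, -, rfl⟩ _ ⟨H, hH, -, rfl⟩; exact hss G hG H hH) F.2.2
    (by rintro _ ⟨G, hG, hGF, rfl⟩; exact hGF)
  -- it suffices to find a vanishing sum over flats that, `F` apart, are proper and not in `s`
  have reduce : ∀ S : Finset (NonemptyFlat M), F ∈ S → (∀ G ∈ S, G ≠ F → G ∉ s) →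
      (∀ G ∈ S, G ≠ F → G.1 ≠ Set.univ) → (∑ G ∈ S, chowVar M G) * P = 0 →
      chowVar M F * P ∈ V := by
    intro S hFS hnew hprop hsum
    rw [← Finset.add_sum_erase S _ hFS, add_mul] at hsum
    rw [eq_neg_of_add_eq_zero_left hsum, Finset.sum_mul]
    refine V.neg_mem (V.sum_mem fun G hG => ?_)
    obtain ⟨hne, hGS⟩ := Finset.mem_erase.1 hG
    exact hV G (hnew G hGS hne) (hprop G hGS hne)
  by_cases hFE : F.1 = Set.univ
  · refine reduce (Finset.univ.filter fun G => a ∈ G.1) (by simpa using haF) ?_ ?_ ?_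
    · intro G hG hne hGs
      refine ha G.1 ⟨G, hGs, ?_, rfl⟩ (Finset.mem_filter.1 hG).2
      rw [hFE, Set.ssubset_univ_iff]
      exact fun h => hne (Subtype.ext (h.trans hFE.symm))
    · exact fun G _ hne h => hne (Subtype.ext (h.trans hFE.symm))
    · rw [sum_chowVar_mem_eq_zero hE, zero_mul]
  · replace hF := hF.resolve_right hFE
    obtain ⟨b, hbF, hb⟩ := exists_notMem_forall_mem_of_isChain
      (T := {X | ∃ G ∈ s, F.1 ⊂ G.1 ∧ G.1 = X})
      (by rintro _ ⟨G, hG, -, rfl⟩ _ ⟨H, hH, -, rfl⟩; exact hss G hG H hH) hFE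
      (by rintro _ ⟨G, hG, hGF, rfl⟩; exact hGF)
    refine reduce (Finset.univ.filter fun G => a ∈ G.1 ∧ b ∉ G.1) (by simpa using ⟨haF, hbF⟩)
      ?_ ?_ ?_
    · intro G hG hne hGs
      obtain ⟨haG, hbG⟩ := (Finset.mem_filter.1 hG).2
      rcases hFs G hGs with h | h
      · exact hbG (hb G.1 ⟨G, hGs, h.ssubset_of_ne fun h => hne (Subtype.ext h.symm), rfl⟩)
      · exact ha G.1 ⟨G, hGs, h.ssubset_of_ne fun h => hne (Subtype.ext h), rfl⟩ haG
    · exact fun G hG _ h => (Finset.mem_filter.1 hG).2.2 (h ▸ Set.mem_univ b)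
    · -- compare the relations of `a` and of `b`: a flat through `b` but not `a` is incomparable
      -- with `F`, which divides the monomial
      have hsplit (x y : E) : ∑ G : NonemptyFlat M with x ∈ G.1, chowVar M G =
          ∑ G : NonemptyFlat M with x ∈ G.1 ∧ y ∈ G.1, chowVar M G +
            ∑ G : NonemptyFlat M with x ∈ G.1 ∧ y ∉ G.1, chowVar M G := by
        rw [← Finset.sum_filter_add_sum_filter_not
          (Finset.univ.filter fun G : NonemptyFlat M => x ∈ G.1) (fun G => y ∈ G.1),
          Finset.filter_filter, Finset.filter_filter]
      have hab := hsplit a b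
      have hba := hsplit b a
      rw [sum_chowVar_mem_eq_zero hE] at hab hba
      simp only [and_comm (a := b ∈ _) (b := a ∈ _)] at hba
      have hzero : (∑ G : NonemptyFlat M with b ∈ G.1 ∧ a ∉ G.1, chowVar M G) * P = 0 := by
        rw [Finset.sum_mul]
        refine Finset.sum_eq_zero fun G hG => ?_
        obtain ⟨hbG, haG⟩ := (Finset.mem_filter.1 hG).2
        rw [hP, ← Multiset.prod_map_erase hF, ← mul_assoc,
          chowVar_mul_chowVar_eq_zero (fun h => hbF (h hbG)) (fun h => haG (h haF)), zero_mul]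
      have h1 := congrArg (· * P) hab
      have h2 := congrArg (· * P) hba
      simp only [zero_mul, add_mul] at h1 h2
      linear_combination h2 - h1 + hzero

theorem prod_chowVar_mem_of_isChain (hE : M.E = Set.univ) {d : ℕ} {T : Finset (NonemptyFlat M)}
    (hT : T.card = d) (hchain : ∀ G ∈ T, ∀ H ∈ T, G.1 ⊆ H.1 ∨ H.1 ⊆ G.1)
    (hprop : ∀ G ∈ T, G.1 ≠ Set.univ) : ∏ G ∈ T, chowVar M G ∈ flagProducts M d := by
  classical
  have hinj : Set.InjOn (fun G : NonemptyFlat M => G.1.ncard) T := by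
    intro G hG H hH hGH
    rcases hchain G hG H hH with h | h
    · exact Subtype.ext (Set.eq_of_subset_of_ncard_le h hGH.ge (Set.toFinite _))
    · exact Subtype.ext (Set.eq_of_subset_of_ncard_le h hGH.le (Set.toFinite _)).symm
  have hcard : (T.image fun G => G.1.ncard).card = d := by
    rw [Finset.card_image_of_injOn hinj, hT]
  have hex (i : Fin d) : ∃ G ∈ T, G.1.ncard = (T.image fun G => G.1.ncard).orderEmbOfFin hcard i :=
    Finset.mem_image.1 (Finset.orderEmbOfFin_mem _ hcard i)
  choose F hFT hF using hex
  have hmono : StrictMono fun i => (F i).1 := by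
    intro i j hij
    have hlt : (F i).1.ncard < (F j).1.ncard := by
      rw [hF, hF]
      exact (Finset.orderEmbOfFin _ hcard).strictMono hij
    rcases hchain _ (hFT i) _ (hFT j) with h | h
    · exact h.ssubset_of_ne fun h' => by rw [h'] at hlt; exact lt_irrefl _ hlt
    · exact absurd (Set.ncard_le_ncard h (Set.toFinite _)) (not_le.2 hlt)
  have hFinj : Function.Injective F := fun i j hij => hmono.injective (congrArg Subtype.val hij)
  refine ⟨F, hmono, fun i => hE ▸ hprop _ (hFT i), ?_⟩
  have himage : Finset.univ.image F = T := by
    refine Finset.eq_of_subset_of_card_le ?_ ?_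
    · exact Finset.image_subset_iff.2 fun i _ => hFT i
    · rw [Finset.card_image_of_injective _ hFinj, hT, Finset.card_univ, Fintype.card_fin]
  rw [← himage, Finset.prod_image fun i _ j _ h => hFinj h]

theorem prod_chowVar_mem_span [M.Loopless] (hE : M.E = Set.univ) {d : ℕ}
    (s : Multiset (NonemptyFlat M)) (hs : s.card = d) :
    (s.map (chowVar M)).prod ∈ Submodule.span ℝ (flagProducts M d) := by
  classical
  -- induction on the number of distinct proper flats that are missing
  induction hn : d - (s.toFinset.filter fun G => G.1 ≠ Set.univ).card using Nat.strong_induction_on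
    generalizing s with
  | _ n ih =>
  by_cases hchain : ∀ G ∈ s, ∀ H ∈ s, G.1 ⊆ H.1 ∨ H.1 ⊆ G.1
  swap
  · push Not at hchain
    obtain ⟨G, hG, H, hH, hGH, hHG⟩ := hchain
    have hHs : H ∈ s.erase G := 
      (Multiset.mem_erase_of_ne fun h => hGH (congrArg Subtype.val h).ge).2 hH
    rw [← Multiset.prod_map_erase hG, ← Multiset.prod_map_erase hHs, ← mul_assoc,
      chowVar_mul_chowVar_eq_zero hGH hHG, zero_mul]
    exact Submodule.zero_mem _
  by_cases hflag : s.Nodup ∧ ∀ G ∈ s, G.1 ≠ Set.univ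
  · exact Submodule.subset_span (prod_chowVar_mem_of_isChain hE (T := ⟨s, hflag.1⟩) hs hchain
      hflag.2)
  have hex : ∃ F t, s = F ::ₘ t ∧ (F ∈ t ∨ F.1 = Set.univ) := by
    by_cases hnd : s.Nodup
    · have : ¬ ∀ G ∈ s, G.1 ≠ Set.univ := fun h => hflag ⟨hnd, h⟩
      push Not at this
      obtain ⟨F, hFs, hF⟩ := this
      obtain ⟨t, rfl⟩ := Multiset.exists_cons_of_mem hFs
      exact ⟨F, t, rfl, Or.inr hF⟩
    · rw [Multiset.nodup_iff_le] at hnd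
      push Not at hnd
      obtain ⟨F, hF⟩ := hnd
      obtain ⟨t, rfl⟩ := Multiset.le_iff_exists_add.1 hF
      exact ⟨F, F ::ₘ t, by simp, Or.inl (Multiset.mem_cons_self F t)⟩
  obtain ⟨F, t, rfl, hF⟩ := hex
  rw [Multiset.map_cons, Multiset.prod_cons]
  refine cons_prod_chowVar_mem hE _ hchain hF fun G hG hGE => ?_
  rw [← Multiset.prod_cons, ← Multiset.map_cons]
  have hcard : (G ::ₘ t).card = d := by rw [← hs, Multiset.card_cons, Multiset.card_cons]
  refine ih _ ?_ (G ::ₘ t) hcard rfl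
  have hfilterF : ((F ::ₘ t).toFinset.filter fun G => G.1 ≠ Set.univ) =
      t.toFinset.filter fun G => G.1 ≠ Set.univ := by
    rw [Multiset.toFinset_cons, Finset.filter_insert]
    split_ifs with h
    · rw [Finset.insert_eq_of_mem]
      exact Finset.mem_filter.2 ⟨Multiset.mem_toFinset.2 (hF.resolve_right h), h⟩
    · rfl
  have hfilterG : ((G ::ₘ t).toFinset.filter fun G => G.1 ≠ Set.univ).card =
      (t.toFinset.filter fun G => G.1 ≠ Set.univ).card + 1 := by
    rw [Multiset.toFinset_cons, Finset.filter_insert, if_pos hGE, Finset.card_insert_of_notMem]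
    exact fun h => hG (Multiset.mem_toFinset.1 (Finset.mem_filter.1 h).1)
  have hle : ((G ::ₘ t).toFinset.filter fun G => G.1 ≠ Set.univ).card ≤ d :=
    (Finset.card_filter_le _ _).trans ((Multiset.toFinset_card_le _).trans hcard.le)
  rw [← hn, hfilterF]
  omega

theorem chowPiece_le_span [M.Loopless] (hE : M.E = Set.univ) (d : ℕ) :
    chowPiece M d ≤ Submodule.span ℝ (flagProducts M d) := by
  classical
  rintro _ ⟨p, hp, rfl⟩
  rw [p.as_sum, map_sum]
  refine Submodule.sum_mem _ fun m hm => ?_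
  have hdeg : (Finsupp.toMultiset m).card = d := by
    rw [Finsupp.card_toMultiset, ← hp (mem_support_iff.1 hm), Finsupp.weight_apply]
    simp [Finsupp.sum]
  have hmon : monomial m (coeff m p) = coeff m p • ((Finsupp.toMultiset m).map X).prod := by
    rw [← monomial_toFinsupp_eq_prod, Finsupp.toMultiset_toFinsupp, smul_monomial, smul_eq_mul,
      mul_one]
  rw [hmon, map_smul, AlgHom.toLinearMap_apply, map_multiset_prod, Multiset.map_map]
  exact Submodule.smul_mem _ _ (prod_chowVar_mem_span hE _ hdeg)

theorem span_flagProducts_le (d : ℕ) : Submodule.span ℝ (flagProducts M d) ≤ chowPiece M d := by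
  rw [Submodule.span_le]
  rintro _ ⟨F, -, -, rfl⟩
  exact chowPiece_prod_mem M _ fun i => chowVar_mem M (F i)

theorem IsDegreeMap.unique [M.Loopless] (hE : M.E = Set.univ) {d : ℕ}
    {φ φ' : chowPiece M d →ₗ[ℝ] ℝ} (hφ : IsDegreeMap M d φ) (hφ' : IsDegreeMap M d φ') :
    φ = φ' := by
  ext ⟨x, hx⟩
  refine Submodule.span_induction
    (p := fun x _ => ∀ hx : x ∈ chowPiece M d, φ ⟨x, hx⟩ = φ' ⟨x, hx⟩) ?_ ?_ ?_ ?_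
    (chowPiece_le_span hE d hx) hx
  · rintro _ ⟨F, hF, hFE, rfl⟩ hx
    exact (hφ F hF hFE).trans (hφ' F hF hFE).symm
  · intro h0
    exact (map_zero φ).trans (map_zero φ').symm
  · intro x y hx hy ihx ihy _
    have hx' := span_flagProducts_le d hx
    have hy' := span_flagProducts_le d hy
    have := congrArg₂ (· + ·) (ihx hx') (ihy hy')
    rw [← map_add, ← map_add] at this
    exact this
  · intro c x hx ih _
    have := congrArg (c • ·) (ih (span_flagProducts_le d hx))
    rw [← map_smul, ← map_smul] at this
    exact this

end Span

/-! ### The degree map -/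

section Degree

variable {E : Type*} [Finite E] {M : Matroid E}

/-- A functional on the Chow ring given by the dragon Hall–Rado condition restricts to the degree
map. -/
theorem isDegreeMap_domRestrict [M.Loopless] (hE : M.E = Set.univ) {d : ℕ}
    (hd : M.eRank = (d : ℕ∞) + 1) {ψ : ChowRing M →ₗ[ℝ] ℝ}
    (hψ : ∀ s : Multiset (Set E), (∀ X ∈ s, X.Nonempty) →
      (MultisetDHR M s → ψ (s.map (simplicialGen M)).prod = 1) ∧
      (¬ MultisetDHR M s → ∀ w, ψ ((s.map (simplicialGen M)).prod * w) = 0)) :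
    IsDegreeMap M d (ψ.domRestrict (chowPiece M d)) := by
  intro F hF hFE
  have hpos : M.E.Nonempty := by
    refine Set.nonempty_iff_ne_empty.2 fun h => ?_
    rw [← M.eRk_ground, h, M.eRk_empty] at hd
    exact absurd hd.symm (by simp)
  let G : ℕ → NonemptyFlat M := fun i =>
    if h : i < d then F ⟨i, h⟩ else ⟨M.E, M.ground_isFlat, hpos⟩
  have hG : ∀ i < d, (G i).1 ⊂ (G (i + 1)).1 := by
    intro i hi
    by_cases hi' : i + 1 < d
    · simp only [G, dif_pos hi, dif_pos hi']
      exact hF (by simp)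
    · simp only [G, dif_pos hi, dif_neg hi']
      exact (F ⟨i, hi⟩).2.1.subset_ground.ssubset_of_ne (hFE _)
  have hGd : (G d).1 = Set.univ := by simp [G, hE]
  rw [LinearMap.domRestrict_apply, ← apply_prod_flag_eq_one hE hd hψ hG hGd, Finset.prod_range]
  simp [G]

end Degree

end SimplicialChow

theorem mainTheorem6 {E : Type*} [Finite E] (M : Matroid E) (hE : M.E = Set.univ) [M.Loopless]
    (d : ℕ) (hd : M.eRank = (d : ℕ∞) + 1) :
    (∃! φ : chowPiece M d →ₗ[ℝ] ℝ, IsDegreeMap M d φ) ∧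
    IsDegreeMap M d (degreeMap M d) ∧
    ∀ (A : Fin d → Set E) (hA : ∀ i, (A i).Nonempty),
      (interHyper M A hA = uniformMatroid E 1 ↔ DragonHallRado M A) ∧
      (DragonHallRado M A →
        degreeMap M d ⟨∏ i, simplicialGen M (A i),
          chowPiece_prod_mem M _ fun i => simplicialGen_mem M (A i)⟩ = 1) ∧
      (¬ DragonHallRado M A →
        degreeMap M d ⟨∏ i, simplicialGen M (A i),
          chowPiece_prod_mem M _ fun i => simplicialGen_mem M (A i)⟩ = 0) := by
  obtain ⟨ψ, hψ⟩ := exists_chowFunctional M hE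
  have hφ := isDegreeMap_domRestrict hE hd hψ
  have hdeg : IsDegreeMap M d (degreeMap M d) := by
    have hex : ∃ φ, IsDegreeMap M d φ := ⟨_, hφ⟩
    rw [degreeMap, dif_pos hex]
    exact hex.choose_spec
  refine ⟨⟨_, hφ, fun φ' hφ' => hφ'.unique hE hφ⟩, hdeg, fun A hA => ?_⟩
  have hprod : ∏ i, simplicialGen M (A i) =
      ((Finset.univ.val.map A).map (simplicialGen M)).prod := by
    rw [Multiset.map_map]
    rfl
  have hne : ∀ X ∈ Finset.univ.val.map A, X.Nonempty := by
    intro X hX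
    obtain ⟨i, -, rfl⟩ := Multiset.mem_map.1 hX
    exact hA i
  rw [hdeg.unique hE hφ, dragonHallRado_iff_multisetDHR]
  simp only [LinearMap.domRestrict_apply, hprod]
  refine ⟨interHyper_eq_uniformMatroid_iff hE hd A hA, (hψ _ hne).1, fun h => ?_⟩
  simpa using (hψ _ hne).2 h 1
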